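/- Let $\rho_s,\sigma,K>0$ and let $\lambda\in C^1([0,\infty);(0,\infty))$ be non-increasing with $|\lambda'(s)|\le K$ for all $s\ge 0$. $PC^1([0,1])$ denotes the set of functions $f:[0,1]\to\mathbb R$ such that: $f$ is left-continuous on $(0,1]$; for every $x\in[0,1)$ the limits $\lim_{y\to x^+}f(y)$ and $\lim_{h\to0^+,\,y\to x^+}h^{-1}(f(y+h)-f(y))$ exist and are finite; $f$ has a finite left derivative at every $x\in(0,1]$; and, for some finite $J\subset(0,1)$, $f$ is differentiable on $(0,1)\setminus J$ with $f'$ continuous there. Notion of solution. Given $h>0$, $u>0$ and $f\in PC^1([0,1])$ with $\inf_{(0,1]}f>0$, a solution on $[0,h]$ of the constant-input problem with input $u$ and initial profile $f$ is a function $y:[0,h]\times[0,1]\to(0,\infty)$ with $y(t,\cdot)\in PC^1([0,1])$ and $\inf_{[0,1]}y(t,\cdot)>0$ for all $t\in[0,h]$, with $V(t)=\int_0^1y(t,x)\,dx$ continuous on $[0,h]$, with $y(0,x)=f(x)$ for $x\in(0,1]$ and $y(t,0)\lambda(V(t))=u$ for $t\in[0,h]$, which is of class $C^1$ and satisfies $y_t+\lambda(V(t))\,y_x=0$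 on $([0,h]\times[0,1])\setminus\Omega$. Here $\Omega$ consists of the points $(t,r_\xi(t))$ with $r_\xi(t)\le1$ and the points $(t,r_\xi(t)-1)$ with $1\le r_\xi(t)\le2$, where $t\in[0,h]$, $r_\xi(t)=\xi+\int_0^t\lambda(V(s))\,ds$, and $\xi$ is either $0$ or a point of $[0,1]$ near which $f$ is not $C^1$. Given times $0=t_0<t_1<\cdots$ with $t_i\to\infty$ and a density $\rho_0$, a global solution of the closed loop with the sample-and-hold controller $$u(t)=u_i=\rho_s\lambda(W(t_i)),\quad t\in[t_i,t_{i+1}),\qquad W(t)=\int_0^1\rho(t,x)\,dx,$$ is a function $\rho:[0,\infty)\times[0,1]\to(0,\infty)$ with $\rho(t,\cdot)\in PC^1([0,1])$ and $\inf_{[0,1]}\rho(t,\cdot)>0$ for all $t\ge0$, with $\rho(0,x)=\rho_0(x)$ for $x\in(0,1]$, such that for each $i\ge0$ there is a solution $y$ on $[0,t_{i+1}-t_i]$ of the constant-input problem with input $u_i$ and initial profile $\rho(t_i,\cdot)$ for which $\rho(t_i+s,x)=y(s,x)$ for $0\le s<t_{i+1}-t_i$, $x\in[0,1]$, and $\rho(t_{i+1},x)=y(t_{i+1}-t_i,x)$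 for $x\in(0,1]$. Theorem. For every $R>0$ there is $\tau>0$ such that for every $\rho_0\in PC^1([0,1])$ with $\inf_{(0,1]}\rho_0>0$ and $L_0:=\sup_{0<x\le1}|\ln(\rho_0(x)/\rho_s)|\le R$, and for every strictly increasing sequence $(t_i)_{i\ge 0}$ with $t_0=0$, $t_i\to\infty$ and $t_{i+1}-t_i\le\tau$ for all $i\ge0$, there is a unique global solution $\rho$ of the closed loop, and it satisfies $$\sup_{0\le x\le1}\left|\ln\frac{\rho(t,x)}{\rho_s}\right|\le\exp\bigl(-\sigma(c\,t-1)\bigr)\,L_0\quad\text{for all }t\ge0,\qquad c=\lambda\bigl(\rho_s\exp(e^{\sigma}L_0)\bigr).$$ -/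

import Mathlib

open Set Filter Topology

namespace Reentrant

/-- The class `PC¹([0,1])`: left-continuous functions on `[0,1]` that are piecewise `C¹`.
Only the values of `f` on `[0,1]` matter, and `f 0` is unrelated to the right limit at `0`. -/
structure IsPC1 (f : ℝ → ℝ) : Prop where
  left_cont : ∀ x ∈ Ioc (0 : ℝ) 1, Tendsto f (𝓝[<] x) (𝓝 (f x))
  right_lim : ∀ x ∈ Ico (0 : ℝ) 1, ∃ l : ℝ, Tendsto f (𝓝[>] x) (𝓝 l)
  right_slope : ∀ x ∈ Ico (0 : ℝ) 1, ∃ l : ℝ,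
    Tendsto (fun p : ℝ × ℝ => p.1⁻¹ * (f (p.2 + p.1) - f p.2)) (𝓝[>] 0 ×ˢ 𝓝[>] x) (𝓝 l)
  left_deriv : ∀ x ∈ Ioc (0 : ℝ) 1, ∃ l : ℝ,
    Tendsto (fun h : ℝ => h⁻¹ * (f (x + h) - f x)) (𝓝[<] 0) (𝓝 l)
  piecewise : ∃ J : Set ℝ, J ⊆ Ioo 0 1 ∧ J.Finite ∧
    (∀ x ∈ Ioo (0 : ℝ) 1 \ J, DifferentiableAt ℝ f x) ∧
    ContinuousOn (deriv f) (Ioo (0 : ℝ) 1 \ J)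

/-- The work in progress `∫₀¹ f(x) dx` of a density profile `f`. -/
noncomputable def work (f : ℝ → ℝ) : ℝ := ∫ x in (0 : ℝ)..1, f x

/-- `sup_{x ∈ S} |ln (f(x)/ρs)|`. -/
noncomputable def logSup (ρs : ℝ) (f : ℝ → ℝ) (S : Set ℝ) : ℝ :=
  sSup ((fun x => |Real.log (f x / ρs)|) '' S)

/-- The break points of a profile: the point `0` and all points of `[0,1]` near which the profile
is not `C¹`. -/
def breakPoints (f : ℝ → ℝ) : Set ℝ :=
  {0} ∪ {x ∈ Icc (0 : ℝ) 1 | ¬ ContDiffWithinAt ℝ 1 f (Icc 0 1) x}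

/-- The characteristic curve `ξ + ∫₀ᵗ lam(W(s)) ds` of the density `y`, `W(s) = ∫₀¹ y(s,x) dx`. -/
noncomputable def charCurve (lam : ℝ → ℝ) (y : ℝ → ℝ → ℝ) (ξ t : ℝ) : ℝ :=
  ξ + ∫ s in (0 : ℝ)..t, lam (work (y s))

/-- The exceptional set `Ω` on the time interval `[0,h]`: the characteristics that start at the
break points of the initial profile `f`, and those that enter at `x = 0` at the moment at which one
of the former reaches `x = 1`. -/
def singularSet (lam : ℝ → ℝ) (f : ℝ → ℝ) (y : ℝ → ℝ → ℝ) (h : ℝ) : Set (ℝ × ℝ) :=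
  {p | p.1 ∈ Icc 0 h ∧ ∃ ξ ∈ breakPoints f,
    charCurve lam y ξ p.1 ≤ 1 ∧ p.2 = charCurve lam y ξ p.1} ∪
  {p | p.1 ∈ Icc 0 h ∧ ∃ ξ ∈ breakPoints f,
    1 ≤ charCurve lam y ξ p.1 ∧ charCurve lam y ξ p.1 ≤ 2 ∧ p.2 = charCurve lam y ξ p.1 - 1}

/-- `y` solves, on the time interval `[0,h]` and with the constant input `u`, the problem
`y_t + lam(W(t)) y_x = 0`, `W(t) = ∫₀¹ y(t,x) dx`, `y(t,0) lam(W(t)) = u`,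
`y(0,x) = f(x)` for `x ∈ (0,1]`. -/
structure IsConstInputSolution (lam : ℝ → ℝ) (u : ℝ) (f : ℝ → ℝ) (h : ℝ) (y : ℝ → ℝ → ℝ) :
    Prop where
  pc1 : ∀ t ∈ Icc 0 h, IsPC1 (y t)
  pos : ∀ t ∈ Icc 0 h, ∀ x ∈ Icc (0 : ℝ) 1, 0 < y t x
  inf_pos : ∀ t ∈ Icc 0 h, 0 < sInf (y t '' Icc 0 1)
  work_cont : ContinuousOn (fun t => work (y t)) (Icc 0 h)
  regular : ContDiffOn ℝ 1 (fun p : ℝ × ℝ => y p.1 p.2)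
    ((Icc 0 h ×ˢ Icc 0 1) \ singularSet lam f y h)
  pde : ∀ t x : ℝ, (t, x) ∈ (Icc 0 h ×ˢ Icc 0 1) \ singularSet lam f y h →
    derivWithin (fun s => y s x) (Icc 0 h) t +
      lam (work (y t)) * derivWithin (fun z => y t z) (Icc 0 1) x = 0
  boundary : ∀ t ∈ Icc 0 h, y t 0 * lam (work (y t)) = u
  initial : ∀ x ∈ Ioc (0 : ℝ) 1, y 0 x = f x

/-- `ρ` is a solution for all `t ≥ 0` of the closed loop under the sample-and-hold feedback
`u(t) = ρs * lam(W(tᵢ))` for `t ∈ [tᵢ, tᵢ₊₁)`, with initial density `ρ₀`: on every sampling interval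
it is the solution with constant input that starts from `ρ(tᵢ, ·)`. At the sampling time `tᵢ₊₁`
the profile on `(0,1]` is the terminal one of that solution, while the boundary value at `x = 0` is
already governed by the next input. -/
structure IsSampledSolution (lam : ℝ → ℝ) (ρs : ℝ) (t : ℕ → ℝ) (ρ₀ : ℝ → ℝ) (ρ : ℝ → ℝ → ℝ) :
    Prop where
  pc1 : ∀ s, 0 ≤ s → IsPC1 (ρ s)
  pos : ∀ s, 0 ≤ s → ∀ x ∈ Icc (0 : ℝ) 1, 0 < ρ s x
  inf_pos : ∀ s, 0 ≤ s → 0 < sInf (ρ s '' Icc 0 1)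
  initial : ∀ x ∈ Ioc (0 : ℝ) 1, ρ 0 x = ρ₀ x
  step : ∀ i : ℕ, ∃ y : ℝ → ℝ → ℝ,
    IsConstInputSolution lam (ρs * lam (work (ρ (t i)))) (ρ (t i)) (t (i + 1) - t i) y ∧
    (∀ s ∈ Ico 0 (t (i + 1) - t i), ∀ x ∈ Icc (0 : ℝ) 1, ρ (t i + s) x = y s x) ∧
    (∀ x ∈ Ioc (0 : ℝ) 1, ρ (t (i + 1)) x = y (t (i + 1) - t i) x)

end Reentrant

/-!
As long as a sampling interval `[0,h]` satisfies `lam 0 * h < 1`, nothing that enters during it leaves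
again. With the displacement `r t = ∫₀ᵗ lam (W s) ds` and its inverse `q`, the density is then a
travelling profile `y t x = G (x - r t)`, where `G` is the initial profile on `(0,1]` and
`G z = u / lam (W (q (-z)))` for `z ≤ 0` (`inflowProfile`). Counting what enters and what leaves gives
`W t = work f + u * t - outflow f (r t)`, where `outflow f w = ∫_{1-w}^1 f` depends on the data only
(`work_inflowProfile`). So the nonlocal hyperbolic problem reduces to the scalar equation
`r' = lam (work f + u * t - outflow f r)`, whose right-hand side is Lipschitz in `r` because a
piecewise `C¹` profile is bounded.

* Uniqueness: a solution is constant along the characteristics that avoid the exceptional set; all but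
  finitely many do, and left-continuity in `x` fills in the remaining points. Hence every solution is
  of the above form (`IsConstInputSolution.exists_representation`), and the scalar equation has one
  solution (`IsConstInputSolution.unique`).
* Existence: the Picard–Lindelöf theorem gives `r`. The regularity of `G` at `z < 0` follows from
  `u / lam (work f + u * q (-z) - outflow f (-z))` (`inflowDensity`), which is `C¹` wherever `f` is
  continuous near `1 + z`, and whose derivative has one-sided limits everywhere
  (`exists_isConstInputSolution`).
* Decay: let `|log (f x / ρs)| ≤ A * exp (σ * x)` at a sampling time. Matter already present keeps its
  density while moving to the right at a speed at least `c`, so the weight `exp (σ * x)` improves its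
  bound by `exp (-σ * c * t)`. Matter that enters has the density `ρs * lam (W 0) / lam (W s)`, and
  `|W s - W 0|` is at most a constant times `h * A`; for small `h` this is below `A * exp (-σ)`
  (`IsConstInputSolution.abs_log_le`). The resulting bound `A * exp (σ * (x - c * t))` has the same
  form and is iterated over the sampling intervals (`IsSampledSolution.abs_log_le`).
-/

namespace Reentrant

/-! ### One-variable calculus -/

theorem contDiffAt_one_of_hasDerivAt {g g' : ℝ → ℝ} {z : ℝ}
    (h : ∀ᶠ w in 𝓝 z, HasDerivAt g (g' w) w) (hc : ∀ᶠ w in 𝓝 z, ContinuousAt g' w) :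
    ContDiffAt ℝ 1 g z := by
  rw [contDiffAt_one_iff]
  refine ⟨fun w => ContinuousLinearMap.toSpanSingleton ℝ (g' w),
    {w | HasDerivAt g (g' w) w ∧ ContinuousAt g' w}, h.and hc, ?_, ?_⟩
  · intro w hw
    have h1 : Continuous fun y : ℝ => ContinuousLinearMap.toSpanSingleton ℝ y :=
      (ContinuousLinearMap.toSpanSingletonCLE (𝕜 := ℝ) (E := ℝ)).continuous
    exact (h1.continuousAt.comp hw.2).continuousWithinAt
  · intro w hw
    exact hw.1.hasFDerivAt

theorem continuousAt_deriv_of_contDiffAt {g : ℝ → ℝ} {z : ℝ} (h : ContDiffAt ℝ 1 g z) :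
    ContinuousAt (deriv g) z := by
  have h1 : ContDiffAt ℝ 0 (fderiv ℝ g) z := h.fderiv_right (by norm_num)
  have h2 : ContinuousAt (fun w => fderiv ℝ g w 1) z := h1.continuousAt.clm_apply continuousAt_const
  exact h2

/-- If the derivative of `g` has the limit `l` at `z` from the right, then the difference quotients
of `g` between two points tend to `l` when both points tend to `z` from the right. -/
theorem tendsto_rightSlope_of_deriv {g g' : ℝ → ℝ} {z l : ℝ}
    (h : ∀ᶠ w in 𝓝[>] z, HasDerivAt g (g' w) w) (hl : Tendsto g' (𝓝[>] z) (𝓝 l)) :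
    Tendsto (fun p : ℝ × ℝ => p.1⁻¹ * (g (p.2 + p.1) - g p.2)) (𝓝[>] 0 ×ˢ 𝓝[>] z) (𝓝 l) := by
  rw [Metric.tendsto_nhds]
  intro ε hε
  have h1 := h.and ((Metric.tendsto_nhds.1 hl) ε hε)
  obtain ⟨b, hb, hb'⟩ := (mem_nhdsGT_iff_exists_Ioo_subset).1 h1
  have hb0 : z < b := hb
  have e1 : ∀ᶠ x in 𝓝[>] (0 : ℝ), x ∈ Ioo 0 ((b - z) / 2) :=
    Ioo_mem_nhdsGT (by linarith)
  have e2 : ∀ᶠ x in 𝓝[>] z, x ∈ Ioo z ((b + z) / 2) :=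
    Ioo_mem_nhdsGT (by linarith)
  filter_upwards [e1.prod_mk e2] with p hp
  obtain ⟨⟨hp1, hp2⟩, hp3, hp4⟩ := hp
  have hd : ∀ w ∈ Icc p.2 (p.2 + p.1), HasDerivAt g (g' w) w ∧ dist (g' w) l < ε := by
    intro w hw
    exact hb' ⟨by linarith [hw.1], by linarith [hw.2]⟩
  obtain ⟨c, hc, hce⟩ := exists_hasDerivAt_eq_slope g g' (a := p.2) (b := p.2 + p.1) (by linarith)
    (fun w hw => (hd w hw).1.continuousAt.continuousWithinAt)
    (fun w hw => (hd w (Ioo_subset_Icc_self hw)).1)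
  have h3 : p.1⁻¹ * (g (p.2 + p.1) - g p.2) = g' c := by
    rw [hce]; rw [add_sub_cancel_left]; field_simp
  rw [h3]
  exact (hd c (Ioo_subset_Icc_self hc)).2

theorem tendsto_rightSlope_congr {f g : ℝ → ℝ} {z l : ℝ} (h : f =ᶠ[𝓝[>] z] g)
    (hf : Tendsto (fun p : ℝ × ℝ => p.1⁻¹ * (f (p.2 + p.1) - f p.2)) (𝓝[>] 0 ×ˢ 𝓝[>] z) (𝓝 l)) :
    Tendsto (fun p : ℝ × ℝ => p.1⁻¹ * (g (p.2 + p.1) - g p.2)) (𝓝[>] 0 ×ˢ 𝓝[>] z) (𝓝 l) := by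
  obtain ⟨b, hb, hb'⟩ := (mem_nhdsGT_iff_exists_Ioo_subset).1 h
  have hb0 : z < b := hb
  have e1 : ∀ᶠ x in 𝓝[>] (0 : ℝ), x ∈ Ioo 0 ((b - z) / 2) :=
    Ioo_mem_nhdsGT (by linarith)
  have e2 : ∀ᶠ x in 𝓝[>] z, x ∈ Ioo z ((b + z) / 2) :=
    Ioo_mem_nhdsGT (by linarith)
  refine hf.congr' ?_
  filter_upwards [e1.prod_mk e2] with p hp
  obtain ⟨⟨h1, h2⟩, h3, h4⟩ := hp
  have g1 : f (p.2 + p.1) = g (p.2 + p.1) := hb' ⟨by linarith, by linarith⟩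
  have g2 : f p.2 = g p.2 := hb' ⟨h3, by linarith⟩
  rw [g1, g2]

theorem tendsto_add_nhdsLT (z : ℝ) : Tendsto (fun h : ℝ => z + h) (𝓝[<] 0) (𝓝[<] z) := by
  refine tendsto_nhdsWithin_iff.2 ⟨?_, ?_⟩
  · refine Tendsto.mono_left ?_ nhdsWithin_le_nhds
    have : ContinuousAt (fun h : ℝ => z + h) 0 := by fun_prop
    simpa [ContinuousAt] using this
  · filter_upwards [self_mem_nhdsWithin] with h hh
    have : h < 0 := hh
    simpa using this

theorem tendsto_sub_nhdsLT (b x : ℝ) : Tendsto (fun x' => x' - b) (𝓝[<] x) (𝓝[<] (x - b)) := by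
  refine tendsto_nhdsWithin_iff.2 ⟨?_, ?_⟩
  · exact (Continuous.tendsto (by fun_prop : Continuous fun x' => x' - b) x).mono_left
      nhdsWithin_le_nhds
  · filter_upwards [self_mem_nhdsWithin] with x' hx'
    have : x' < x := hx'
    simpa using this

theorem tendsto_sub_nhdsGT (b x : ℝ) : Tendsto (fun x' => x' - b) (𝓝[>] x) (𝓝[>] (x - b)) := by
  refine tendsto_nhdsWithin_iff.2 ⟨?_, ?_⟩
  · exact (Continuous.tendsto (by fun_prop : Continuous fun x' => x' - b) x).mono_left
      nhdsWithin_le_nhds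
  · filter_upwards [self_mem_nhdsWithin] with x' hx'
    have : x < x' := hx'
    simpa using this

theorem tendsto_leftSlope_congr {f g : ℝ → ℝ} {z l : ℝ} (h : f =ᶠ[𝓝[<] z] g) (hz : f z = g z)
    (hf : Tendsto (fun h : ℝ => h⁻¹ * (f (z + h) - f z)) (𝓝[<] 0) (𝓝 l)) :
    Tendsto (fun h : ℝ => h⁻¹ * (g (z + h) - g z)) (𝓝[<] 0) (𝓝 l) := by
  refine hf.congr' ?_
  filter_upwards [(tendsto_add_nhdsLT z).eventually h] with y hy
  rw [hy, hz]

/-- If the derivative of `g` has the limit `l` at `z` from the left and `g` is continuous at `z`,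
then `l` is the left derivative of `g` at `z`. -/
theorem tendsto_leftSlope_of_deriv {g g' : ℝ → ℝ} {z l : ℝ} (hg : ContinuousAt g z)
    (h : ∀ᶠ w in 𝓝[<] z, HasDerivAt g (g' w) w) (hl : Tendsto g' (𝓝[<] z) (𝓝 l)) :
    Tendsto (fun h : ℝ => h⁻¹ * (g (z + h) - g z)) (𝓝[<] 0) (𝓝 l) := by
  have h1 : HasDerivWithinAt g l (Iic z) z := by
    refine hasDerivWithinAt_Iic_of_tendsto_deriv (s := {w | HasDerivAt g (g' w) w}) ?_
      hg.continuousWithinAt h ?_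
    · intro w hw
      exact (HasDerivAt.differentiableAt hw).differentiableWithinAt
    · refine hl.congr' ?_
      filter_upwards [h] with w hw using hw.deriv.symm
  have h2 := (hasDerivWithinAt_iff_tendsto_slope' (by simp)).1 (h1.mono Iio_subset_Iic_self)
  refine (h2.comp (tendsto_add_nhdsLT z)).congr ?_
  intro h
  simp [slope_def_field]
  ring

/-! ### Piecewise `C¹` profiles -/

section PC1

variable {f : ℝ → ℝ}

/-- Membership in `PC¹([0,1])` does not depend on the values outside `(0,1]`. -/
theorem IsPC1.congr {g : ℝ → ℝ} (hf : IsPC1 f) (h : EqOn f g (Ioc 0 1)) : IsPC1 g := by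
  have hI : ∀ x ∈ Ioo (0 : ℝ) 1, f =ᶠ[𝓝 x] g := fun x hx =>
    (h.mono Ioo_subset_Ioc_self).eventuallyEq_of_mem (Ioo_mem_nhds hx.1 hx.2)
  have hl : ∀ x ∈ Ioc (0 : ℝ) 1, f =ᶠ[𝓝[<] x] g := fun x hx =>
    h.eventuallyEq_of_mem (mem_of_superset (Ioo_mem_nhdsLT hx.1)
      fun y hy => ⟨hy.1, hy.2.le.trans hx.2⟩)
  have hr : ∀ x ∈ Ico (0 : ℝ) 1, f =ᶠ[𝓝[>] x] g := fun x hx =>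
    h.eventuallyEq_of_mem (mem_of_superset (Ioo_mem_nhdsGT hx.2)
      fun y hy => ⟨hx.1.trans_lt hy.1, hy.2.le⟩)
  refine ⟨?_, ?_, ?_, ?_, ?_⟩
  · intro x hx
    rw [← h hx]
    exact (hf.left_cont x hx).congr' (hl x hx)
  · intro x hx
    obtain ⟨l, hl⟩ := hf.right_lim x hx
    exact ⟨l, hl.congr' (hr x hx)⟩
  · intro x hx
    obtain ⟨l, hl⟩ := hf.right_slope x hx
    exact ⟨l, tendsto_rightSlope_congr (hr x hx) hl⟩
  · intro x hx
    obtain ⟨l, hlx⟩ := hf.left_deriv x hx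
    exact ⟨l, tendsto_leftSlope_congr (hl x hx) (h hx) hlx⟩
  · obtain ⟨J, hJ, hJf, hd, hc⟩ := hf.piecewise
    refine ⟨J, hJ, hJf, ?_, ?_⟩
    · intro x hx
      exact (hd x hx).congr_of_eventuallyEq (hI x hx.1).symm
    · refine hc.congr ?_
      intro x hx
      exact (hI x hx.1).symm.deriv_eq

/-- One-sided limits at every point give local bounds, hence a global one by compactness. Since `sSup`
of an unbounded set is `0`, this is also what gives `logSup` its meaning. -/
theorem IsPC1.exists_bound (hf : IsPC1 f) : ∃ M, 0 < M ∧ ∀ x ∈ Ioc (0 : ℝ) 1, |f x| ≤ M := by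
  have key : ∃ M, ∀ x ∈ Icc (0 : ℝ) 1 ∩ Ioc 0 1, |f x| ≤ M := by
    refine IsCompact.induction_on (s := Icc (0 : ℝ) 1)
      (p := fun s => ∃ M, ∀ x ∈ s ∩ Ioc 0 1, |f x| ≤ M) isCompact_Icc ⟨0, by simp⟩ ?_ ?_ ?_
    · rintro s t hst ⟨M, hM⟩
      exact ⟨M, fun x hx => hM x ⟨hst hx.1, hx.2⟩⟩
    · rintro s t ⟨M, hM⟩ ⟨N, hN⟩
      refine ⟨max M N, ?_⟩
      rintro x ⟨hx | hx, hx'⟩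
      · exact (hM x ⟨hx, hx'⟩).trans (le_max_left _ _)
      · exact (hN x ⟨hx, hx'⟩).trans (le_max_right _ _)
    · intro x hx
      have hr : ∃ M, ∀ᶠ y in 𝓝[>] x, y ∈ Ioc (0 : ℝ) 1 → |f y| ≤ M := by
        rcases hx.2.lt_or_eq with h | h
        · obtain ⟨l, hl⟩ := hf.right_lim x ⟨hx.1, h⟩
          refine ⟨|l| + 1, ?_⟩
          filter_upwards [hl.abs.eventually (Iio_mem_nhds (lt_add_one |l|))] with y hy _
          exact le_of_lt hy
        · refine ⟨0, ?_⟩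
          filter_upwards [self_mem_nhdsWithin] with y hy hy'
          exact absurd hy'.2 (not_le.2 (h ▸ hy))
      have hl : ∃ M, ∀ᶠ y in 𝓝[<] x, y ∈ Ioc (0 : ℝ) 1 → |f y| ≤ M := by
        rcases hx.1.lt_or_eq with h | h
        · have hl := hf.left_cont x ⟨h, hx.2⟩
          refine ⟨|f x| + 1, ?_⟩
          filter_upwards [hl.abs.eventually (Iio_mem_nhds (lt_add_one |f x|))] with y hy _
          exact le_of_lt hy
        · refine ⟨0, ?_⟩
          filter_upwards [self_mem_nhdsWithin] with y hy hy'
          exact absurd hy'.1 (not_lt.2 (h ▸ (le_of_lt hy)))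
      obtain ⟨M, hM⟩ := hr
      obtain ⟨N, hN⟩ := hl
      have h1 : ∀ᶠ y in 𝓝[≠] x, y ∈ Ioc (0 : ℝ) 1 → |f y| ≤ max M N := by
        rw [← Iio_union_Ioi, nhdsWithin_union]
        refine eventually_sup.2 ⟨?_, ?_⟩
        · filter_upwards [hN] with y hy h using (hy h).trans (le_max_right _ _)
        · filter_upwards [hM] with y hy h using (hy h).trans (le_max_left _ _)
      have h2 : ∀ᶠ y in 𝓝 x, y ∈ Ioc (0 : ℝ) 1 → |f y| ≤ max (max M N) |f x| := by
        rw [← nhdsNE_sup_pure, eventually_sup]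
        refine ⟨?_, ?_⟩
        · filter_upwards [h1] with y hy h using (hy h).trans (le_max_left _ _)
        · simp
      exact ⟨_, mem_nhdsWithin_of_mem_nhds h2, _, fun y hy => hy.1 hy.2⟩
  obtain ⟨M, hM⟩ := key
  exact ⟨max M 1, by positivity, fun x hx =>
    (hM x ⟨Ioc_subset_Icc_self hx, hx⟩).trans (le_max_left _ _)⟩

theorem IsPC1.exists_finite_contDiffAt (hf : IsPC1 f) :
    ∃ J : Set ℝ, J.Finite ∧ ∀ x ∈ Ioo (0 : ℝ) 1 \ J, ContDiffAt ℝ 1 f x := by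
  obtain ⟨J, hJ, hJf, hd, hc⟩ := hf.piecewise
  refine ⟨J, hJf, fun x hx => ?_⟩
  have hU : IsOpen (Ioo (0 : ℝ) 1 \ J) := isOpen_Ioo.sdiff hJf.isClosed
  have := hU.mem_nhds hx
  refine contDiffAt_one_of_hasDerivAt (g' := deriv f) ?_ ?_
  · filter_upwards [this] with w hw using (hd w hw).hasDerivAt
  · filter_upwards [this] with w hw using (hc w hw).continuousAt (hU.mem_nhds hw)

theorem IsPC1.finite_breakPoints (hf : IsPC1 f) : (breakPoints f).Finite := by
  obtain ⟨J, hJ, h⟩ := hf.exists_finite_contDiffAt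
  refine (((finite_singleton (0 : ℝ)).union (finite_singleton 1)).union hJ).subset ?_
  rintro x (hx | ⟨hx, hx'⟩)
  · exact Or.inl (Or.inl hx)
  · by_contra hcon
    simp only [mem_union, mem_singleton_iff, not_or] at hcon
    exact hx' (h x ⟨⟨lt_of_le_of_ne hx.1 (Ne.symm hcon.1.1), lt_of_le_of_ne hx.2 hcon.1.2⟩,
      hcon.2⟩).contDiffWithinAt

/-- The extension of a profile from `(0,1]` to the real line by its value at `1`: it makes the
cumulative content `∫_{1-w}^1` of the profile a globally Lipschitz function of `w`. -/
noncomputable def profileExt (f : ℝ → ℝ) (x : ℝ) : ℝ := by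
  classical exact if x ∈ Ioc (0 : ℝ) 1 then f x else f 1

theorem profileExt_of_mem {x : ℝ} (hx : x ∈ Ioc (0 : ℝ) 1) : profileExt f x = f x := by
  simp only [profileExt, hx, if_true]

theorem abs_profileExt_le {M : ℝ} (hM : ∀ x ∈ Ioc (0 : ℝ) 1, |f x| ≤ M) (x : ℝ) :
    |profileExt f x| ≤ M := by
  unfold profileExt
  split_ifs with h
  · exact hM x h
  · exact hM 1 (by simp)

theorem profileExt_congr {f' : ℝ → ℝ} (h : EqOn f f' (Ioc 0 1)) :
    profileExt f = profileExt f' := by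
  funext x
  unfold profileExt
  split_ifs with hx
  · exact h hx
  · exact h (by simp)

theorem profileExt_eventuallyEq {x : ℝ} (hx : x ∈ Ioo (0 : ℝ) 1) : profileExt f =ᶠ[𝓝 x] f := by
  filter_upwards [Ioo_mem_nhds hx.1 hx.2] with y hy
  exact profileExt_of_mem (Ioo_subset_Ioc_self hy)

theorem IsPC1.measurable_profileExt (hf : IsPC1 f) : Measurable (profileExt f) := by
  obtain ⟨J, hJ, h⟩ := hf.exists_finite_contDiffAt
  set E : Set ℝ := J ∪ {0, 1} with hE
  have hEf : E.Finite := hJ.union (by simp)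
  have := hEf.to_subtype
  refine measurable_of_measurable_on_compl_finite E hEf
    (continuousOn_iff_continuous_domRestrict.1 fun x hx => ?_).measurable
  refine ContinuousAt.continuousWithinAt ?_
  simp only [hE, mem_compl_iff, mem_union, mem_insert_iff, mem_singleton_iff, not_or] at hx
  rcases lt_or_gt_of_ne hx.2.1 with h0 | h0
  · have : profileExt f =ᶠ[𝓝 x] fun _ => f 1 := by
      filter_upwards [Iio_mem_nhds h0] with y hy
      have : y ∉ Ioc (0 : ℝ) 1 := fun h => absurd h.1 (not_lt.2 (le_of_lt hy))
      simp only [profileExt, this, if_false]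
    exact continuousAt_const.congr this.symm
  rcases lt_or_gt_of_ne hx.2.2 with h1 | h1
  · exact (h x ⟨⟨h0, h1⟩, hx.1⟩).continuousAt.congr (profileExt_eventuallyEq ⟨h0, h1⟩).symm
  · have : profileExt f =ᶠ[𝓝 x] fun _ => f 1 := by
      filter_upwards [Ioi_mem_nhds h1] with y hy
      have : y ∉ Ioc (0 : ℝ) 1 := fun h => absurd h.2 (not_le.2 hy)
      simp only [profileExt, this, if_false]
    exact continuousAt_const.congr this.symm

theorem IsPC1.intervalIntegrable_profileExt (hf : IsPC1 f) (a b : ℝ) :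
    IntervalIntegrable (profileExt f) MeasureTheory.volume a b := by
  obtain ⟨M, hM, h⟩ := hf.exists_bound
  refine IntervalIntegrable.mono_fun (intervalIntegrable_const (c := M))
    hf.measurable_profileExt.aestronglyMeasurable ?_
  refine Eventually.of_forall fun x => ?_
  simp only [Real.norm_eq_abs]
  exact (abs_profileExt_le h x).trans (le_abs_self M)

theorem integral_profileExt {a b : ℝ} (ha : 0 ≤ a) (hab : a ≤ b) (hb : b ≤ 1) :
    ∫ x in a..b, profileExt f x = ∫ x in a..b, f x := by
  refine intervalIntegral.integral_congr_ae (Eventually.of_forall fun x hx => ?_)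
  rw [uIoc_of_le hab] at hx
  exact profileExt_of_mem ⟨ha.trans_lt hx.1, hx.2.trans hb⟩

theorem IsPC1.intervalIntegrable (hf : IsPC1 f) {a b : ℝ} (ha : 0 ≤ a) (hab : a ≤ b)
    (hb : b ≤ 1) : IntervalIntegrable f MeasureTheory.volume a b := by
  refine (hf.intervalIntegrable_profileExt a b).congr ?_
  intro x hx
  rw [uIoc_of_le hab] at hx
  exact profileExt_of_mem ⟨ha.trans_lt hx.1, hx.2.trans hb⟩

theorem work_eq_profileExt : work f = ∫ x in (0 : ℝ)..1, profileExt f x :=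
  (integral_profileExt le_rfl zero_le_one le_rfl).symm

theorem work_congr {g : ℝ → ℝ} (h : EqOn f g (Ioc 0 1)) : work f = work g := by
  refine intervalIntegral.integral_congr_ae (Eventually.of_forall fun x hx => ?_)
  rw [uIoc_of_le zero_le_one] at hx
  exact h hx

theorem IsPC1.work_pos (hf : IsPC1 f) (hp : ∀ x ∈ Ioc (0 : ℝ) 1, 0 < f x) : 0 < work f := by
  refine intervalIntegral.intervalIntegral_pos_of_pos_on
    (hf.intervalIntegrable le_rfl zero_le_one le_rfl) (fun x hx => hp x ⟨hx.1, hx.2.le⟩)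
    zero_lt_one

/-- The content `∫_{1-w}^1 f` of the last portion of width `w` of a profile. -/
noncomputable def outflow (f : ℝ → ℝ) (w : ℝ) : ℝ := ∫ x in (1 - w)..1, profileExt f x

theorem outflow_zero : outflow f 0 = 0 := by simp [outflow]

theorem IsPC1.work_sub_outflow (hf : IsPC1 f) (w : ℝ) :
    work f - outflow f w = ∫ x in (0 : ℝ)..(1 - w), profileExt f x := by
  rw [work_eq_profileExt, outflow, sub_eq_iff_eq_add]
  exact (intervalIntegral.integral_add_adjacent_intervals
    (hf.intervalIntegrable_profileExt _ _) (hf.intervalIntegrable_profileExt _ _)).symm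

theorem IsPC1.outflow_sub (hf : IsPC1 f) (a b : ℝ) :
    outflow f a - outflow f b = ∫ x in (1 - a)..(1 - b), profileExt f x := by
  rw [outflow, outflow, sub_eq_iff_eq_add]
  exact (intervalIntegral.integral_add_adjacent_intervals
    (hf.intervalIntegrable_profileExt _ _) (hf.intervalIntegrable_profileExt _ _)).symm

theorem IsPC1.abs_outflow_sub_le (hf : IsPC1 f) {M : ℝ} (hM : ∀ x ∈ Ioc (0 : ℝ) 1, |f x| ≤ M)
    (a b : ℝ) : |outflow f a - outflow f b| ≤ M * |a - b| := by
  rw [hf.outflow_sub]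
  have := intervalIntegral.norm_integral_le_of_norm_le_const (a := 1 - a) (b := 1 - b)
    (f := profileExt f) (C := M) (fun x _ => abs_profileExt_le hM x)
  rw [Real.norm_eq_abs] at this
  have h2 : 1 - b - (1 - a) = a - b := by ring
  rwa [h2] at this

theorem IsPC1.continuous_outflow (hf : IsPC1 f) : Continuous (outflow f) := by
  obtain ⟨M, hM, h⟩ := hf.exists_bound
  have : LipschitzWith (Real.toNNReal M) (outflow f) := by
    refine LipschitzWith.of_dist_le_mul fun a b => ?_
    rw [Real.dist_eq, Real.dist_eq, Real.coe_toNNReal _ hM.le]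
    exact hf.abs_outflow_sub_le h a b
  exact this.continuous

theorem IsPC1.hasDerivAt_outflow (hf : IsPC1 f) {w : ℝ}
    (h : ContinuousAt (profileExt f) (1 - w)) :
    HasDerivAt (outflow f) (profileExt f (1 - w)) w := by
  have h1 := intervalIntegral.integral_hasDerivAt_left (hf.intervalIntegrable_profileExt (1 - w) 1)
    hf.measurable_profileExt.stronglyMeasurable.stronglyMeasurableAtFilter h
  have h2 := h1.comp w ((hasDerivAt_id w).const_sub 1)
  rw [mul_neg_one, neg_neg] at h2
  exact h2

end PC1

/-! ### Travelling profiles -/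

/-- The common part of every solution of a constant-input problem: a positive speed and the
distance covered at that speed. The speed `w` is prescribed on `[0,h]` only; it is extended by its
end values so that `r` and its inverse `q` are `C¹` bijections of the whole line. -/
theorem exists_travelTime {h : ℝ} (hh : 0 ≤ h) {v : ℝ → ℝ} (hv : ContinuousOn v (Icc 0 h))
    (hpos : ∀ t ∈ Icc 0 h, 0 < v t) :
    ∃ w r q : ℝ → ℝ, Continuous w ∧ (∀ t, 0 < w t) ∧ EqOn w v (Icc 0 h) ∧
      (∀ t, HasDerivAt r (w t) t) ∧ r 0 = 0 ∧ StrictMono r ∧ StrictMono q ∧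
      (∀ t ∈ Icc 0 h, r t = ∫ s in (0 : ℝ)..t, v s) ∧
      (∀ t, q (r t) = t) ∧ (∀ z, r (q z) = z) ∧ Continuous q ∧
      (∀ z, HasDerivAt q (w (q z))⁻¹ z) := by
  set w : ℝ → ℝ := IccExtend hh ((Icc 0 h).domRestrict v) with hw
  have hwc : Continuous w := (continuousOn_iff_continuous_domRestrict.1 hv).Icc_extend'
  have hwv : EqOn w v (Icc 0 h) := fun t ht => by
    rw [hw, IccExtend_of_mem hh _ ht]; rfl
  obtain ⟨t₀, ht₀, hmin⟩ := isCompact_Icc.exists_isMinOn (nonempty_Icc.2 hh) hv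
  have hlow : ∀ t, v t₀ ≤ w t := fun t => hmin (projIcc 0 h hh t).2
  have hv0 : 0 < v t₀ := hpos t₀ ht₀
  have hwpos : ∀ t, 0 < w t := fun t => hv0.trans_le (hlow t)
  set r : ℝ → ℝ := fun t => ∫ s in (0 : ℝ)..t, w s with hr
  have hrd : ∀ t, HasDerivAt r (w t) t := fun t =>
    intervalIntegral.integral_hasDerivAt_right (hwc.intervalIntegrable _ _)
      hwc.stronglyMeasurable.stronglyMeasurableAtFilter hwc.continuousAt
  have hr0 : r 0 = 0 := by simp [hr]
  have hmono : StrictMono r := strictMono_of_deriv_pos fun t => by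
    rw [(hrd t).deriv]; exact hwpos t
  have hrc : Continuous r := continuous_iff_continuousAt.2 fun t => (hrd t).continuousAt
  have hmono' : Monotone fun t => r t - v t₀ * t := by
    refine monotone_of_deriv_nonneg (fun t => ?_) (fun t => ?_)
    · exact ((hrd t).sub ((hasDerivAt_id t).const_mul (v t₀))).differentiableAt
    · have := ((hrd t).sub ((hasDerivAt_id t).const_mul (v t₀))).deriv
      have h2 : deriv (fun t => r t - v t₀ * t) t = w t - v t₀ * 1 := this
      rw [h2]; linarith [hlow t]
  have hsurj : Function.Surjective r := by
    refine hrc.surjective ?_ ?_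
    · refine tendsto_atTop_mono' _ ?_ (tendsto_id.const_mul_atTop hv0)
      filter_upwards [eventually_ge_atTop 0] with t ht
      have := hmono' ht
      simp only [hr0, mul_zero, sub_zero] at this
      simpa using this
    · refine tendsto_atBot_mono' _ ?_ (tendsto_id.const_mul_atBot hv0)
      filter_upwards [eventually_le_atBot 0] with t ht
      have := hmono' ht
      simp only [hr0, mul_zero, sub_zero] at this
      simpa using this
  set e := hmono.orderIsoOfSurjective r hsurj with he
  have her : ∀ t, e t = r t := fun t => rfl
  have hqr : ∀ t, e.symm (r t) = t := fun t => by rw [← her]; exact e.symm_apply_apply t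
  have hrq : ∀ z, r (e.symm z) = z := fun z => by rw [← her]; exact e.apply_symm_apply z
  have hqc : Continuous e.symm := e.symm.continuous
  refine ⟨w, r, e.symm, hwc, hwpos, hwv, hrd, hr0, hmono, e.symm.strictMono, ?_, hqr, hrq, hqc,
    ?_⟩
  · intro t ht
    refine intervalIntegral.integral_congr fun s hs => hwv ?_
    rw [uIcc_of_le ht.1] at hs
    exact ⟨hs.1, hs.2.trans ht.2⟩
  · intro z
    exact HasDerivAt.of_local_left_inverse hqc.continuousAt (hrd _) (hwpos _).ne'
      (Eventually.of_forall hrq)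

/-- The profile on `(-∞,1]` whose translates are the densities with constant input `u`: on `(0,1]`
the initial density, on `(-∞,0]` the density `u / w` of what enters later; the portion at `z ≤ 0`
enters at the time `q (-z)`. -/
noncomputable def inflowProfile (u : ℝ) (f w q : ℝ → ℝ) (z : ℝ) : ℝ :=
  if 0 < z then f z else u / w (q (-z))

/-- Conservation: after the time `t` the content of the interval is the amount `u * t` that entered
plus that part of the initial content that has not left. -/
theorem work_inflowProfile {u : ℝ} {f w r q : ℝ → ℝ} (hf : IsPC1 f)
    (hw : Continuous w) (hwpos : ∀ t, 0 < w t) (hr0 : r 0 = 0) (hqr : ∀ t, q (r t) = t)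
    (hq : ∀ z, HasDerivAt q (w (q z))⁻¹ z) {t : ℝ} (h0 : 0 ≤ r t) (h1 : r t ≤ 1) :
    work (fun x => inflowProfile u f w q (x - r t)) = work f + u * t - outflow f (r t) := by
  have hqc : Continuous q := continuous_iff_continuousAt.2 fun z => (hq z).continuousAt
  have hcont : Continuous fun x => u / w (q (r t - x)) :=
    continuous_const.div (hw.comp (hqc.comp (continuous_const.sub continuous_id)))
      fun x => (hwpos _).ne'
  have e1 : EqOn (fun x => u / w (q (r t - x))) (fun x => inflowProfile u f w q (x - r t))
      (uIoc 0 (r t)) := by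
    intro x hx
    rw [uIoc_of_le h0] at hx
    have : ¬ 0 < x - r t := by linarith [hx.2]
    simp only [inflowProfile, this, if_false, neg_sub]
  have e2 : EqOn (fun x => profileExt f (x - r t)) (fun x => inflowProfile u f w q (x - r t))
      (uIoc (r t) 1) := by
    intro x hx
    rw [uIoc_of_le h1] at hx
    have : 0 < x - r t := by linarith [hx.1]
    simp only [inflowProfile, this, if_true]
    exact profileExt_of_mem ⟨this, by linarith [hx.2]⟩
  have i1 : ∫ x in (0 : ℝ)..(r t), inflowProfile u f w q (x - r t) = u * t := by
    rw [← intervalIntegral.integral_congr_ae (Eventually.of_forall fun x hx => e1 hx)]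
    have hd : ∀ x ∈ uIcc 0 (r t), HasDerivAt (fun x => -(u * q (r t - x))) (u / w (q (r t - x))) x := by
      intro x _
      have := (((hq (r t - x)).comp x ((hasDerivAt_id x).const_sub (r t))).const_mul u).neg
      exact this.congr_deriv (by rw [mul_neg_one, mul_neg, neg_neg, div_eq_mul_inv])
    rw [intervalIntegral.integral_eq_sub_of_hasDerivAt hd (hcont.intervalIntegrable _ _)]
    have hq0 : q 0 = 0 := by simpa [hr0] using hqr 0
    simp [hq0, hqr]
  have i2 : ∫ x in (r t)..1, inflowProfile u f w q (x - r t) = work f - outflow f (r t) := by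
    rw [← intervalIntegral.integral_congr_ae (Eventually.of_forall fun x hx => e2 hx),
      intervalIntegral.integral_comp_sub_right, hf.work_sub_outflow, sub_self]
  have j1 : IntervalIntegrable (fun x => inflowProfile u f w q (x - r t)) MeasureTheory.volume
      0 (r t) := (hcont.intervalIntegrable _ _).congr e1
  have j2 : IntervalIntegrable (fun x => inflowProfile u f w q (x - r t)) MeasureTheory.volume
      (r t) 1 := by
    refine IntervalIntegrable.congr e2 ?_
    have := (hf.intervalIntegrable_profileExt (r t - r t) (1 - r t)).comp_sub_right (r t)
    simpa using this
  rw [work, ← intervalIntegral.integral_add_adjacent_intervals j1 j2, i1, i2]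
  ring

/-- At the junction `z = 0` the value is the one coming from the left, that is, the density of the
entering matter. -/
theorem tendsto_inflowProfile_left {u : ℝ} {f w q : ℝ → ℝ} (hf : IsPC1 f) (hw : Continuous w)
    (hwpos : ∀ t, 0 < w t) (hq : Continuous q) {z : ℝ} (hz : z ≤ 1) :
    Tendsto (inflowProfile u f w q) (𝓝[<] z) (𝓝 (inflowProfile u f w q z)) := by
  rcases lt_or_ge 0 z with h | h
  · have e : inflowProfile u f w q =ᶠ[𝓝 z] f := by
      filter_upwards [Ioi_mem_nhds h] with y hy
      have : 0 < y := hy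
      simp only [inflowProfile, this, if_true]
    rw [e.eq_of_nhds]
    exact (hf.left_cont z ⟨h, hz⟩).congr' (e.filter_mono nhdsWithin_le_nhds).symm
  · have hcont : Continuous fun x => u / w (q (-x)) :=
      continuous_const.div (hw.comp (hq.comp continuous_neg)) fun x => (hwpos _).ne'
    have e : ∀ y ≤ z, u / w (q (-y)) = inflowProfile u f w q y := fun y hy => by
      simp only [inflowProfile, not_lt.2 (hy.trans h), if_false]
    rw [← e z le_rfl]
    refine ((hcont.tendsto z).mono_left nhdsWithin_le_nhds).congr' ?_
    filter_upwards [self_mem_nhdsWithin] with y hy using e y (le_of_lt hy)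

theorem eventually_notMem_of_finite {N : Set ℝ} (hN : N.Finite) (z : ℝ) :
    ∀ᶠ w in 𝓝[≠] z, w ∉ N := by
  have h : (N \ {z})ᶜ ∈ 𝓝 z := (hN.subset sdiff_subset).isClosed.isOpen_compl.mem_nhds (by simp)
  filter_upwards [mem_nhdsWithin_of_mem_nhds h, self_mem_nhdsWithin] with w hw hwz hwN
  exact hw ⟨hwN, hwz⟩

/-! ### Every solution is a travelling profile -/

section Representation

variable {lam : ℝ → ℝ} {u h : ℝ} {f : ℝ → ℝ} {y : ℝ → ℝ → ℝ}

theorem IsConstInputSolution.work_pos (hy : IsConstInputSolution lam u f h y) {t : ℝ}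
    (ht : t ∈ Icc 0 h) : 0 < work (y t) :=
  (hy.pc1 t ht).work_pos fun x hx => hy.pos t ht x (Ioc_subset_Icc_self hx)

/-- A solution is constant along the characteristics `z + r` that stay clear of the exceptional
set. -/
theorem IsConstInputSolution.eq_along_characteristic (hy : IsConstInputSolution lam u f h y)
    (hf : IsPC1 f) {r w : ℝ → ℝ} (hr : ∀ t, HasDerivAt r (w t) t)
    (hmono : StrictMono r) (hwv : ∀ t ∈ Icc 0 h, w t = lam (work (y t)))
    (hrv : ∀ t ∈ Icc 0 h, r t = ∫ s in (0 : ℝ)..t, lam (work (y s)))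
    {z s₀ s₁ : ℝ} (hz : z ∉ breakPoints f) (hz' : z + 1 ∉ breakPoints f) (h0 : 0 ≤ s₀)
    (h01 : s₀ ≤ s₁) (h1 : s₁ ≤ h) (hx0 : 0 ≤ z + r s₀) (hx1 : z + r s₁ ≤ 1) :
    y s₁ (z + r s₁) = y s₀ (z + r s₀) := by
  rcases h01.eq_or_lt with rfl | hlt
  · rfl
  set S : Set (ℝ × ℝ) := (Icc 0 h ×ˢ Icc 0 1) \ singularSet lam f y h with hS
  set N : Set ℝ := breakPoints f ∪ (fun ξ => ξ + 1) ⁻¹' breakPoints f with hN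
  have hNf : N.Finite :=
    hf.finite_breakPoints.union (hf.finite_breakPoints.preimage (add_left_injective _).injOn)
  have hmem : ∀ t ∈ Icc 0 h, ∀ x ∈ Icc (0 : ℝ) 1, x - r t ∉ N → (t, x) ∈ S := by
    rintro t ht x hx hxN
    refine ⟨⟨ht, hx⟩, ?_⟩
    have hch : ∀ ξ, charCurve lam y ξ t = ξ + r t := fun ξ => by rw [charCurve, hrv t ht]
    rintro (⟨-, ξ, hξ, -, hxe⟩ | ⟨-, ξ, hξ, -, -, hxe⟩)
    · refine hxN (Or.inl ?_)
      have : x - r t = ξ := by have := hxe.trans (hch ξ); simp only at this; linarith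
      rwa [this]
    · refine hxN (Or.inr ?_)
      have : x - r t + 1 = ξ := by
        have h2 := hch ξ
        simp only at hxe h2
        linarith
      rw [mem_preimage, this]; exact hξ
  have hzN : z ∉ N := by rintro (h | h); exacts [hz h, hz' h]
  have hrc : Continuous r := continuous_iff_continuousAt.2 fun t => (hr t).continuousAt
  have hcurve : ∀ s ∈ Icc s₀ s₁, (s, z + r s) ∈ S := by
    intro s hs
    refine hmem s ⟨h0.trans hs.1, hs.2.trans h1⟩ _ ⟨?_, ?_⟩ ?_
    · linarith [hmono.monotone hs.1]
    · linarith [hmono.monotone hs.2]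
    · simpa using hzN
  have hφc : ContinuousOn (fun s => y s (z + r s)) (Icc s₀ s₁) := by
    have := hy.regular.continuousOn.comp (f := fun s : ℝ => (s, z + r s)) (s := Icc s₀ s₁)
      (by fun_prop) hcurve
    exact this
  have hφd : ∀ s ∈ Ioo s₀ s₁, HasDerivAt (fun s => y s (z + r s)) 0 s := by
    intro s hs
    have hs' : s ∈ Ioo 0 h := ⟨h0.trans_lt hs.1, hs.2.trans_le h1⟩
    have hx : z + r s ∈ Ioo (0 : ℝ) 1 := by
      constructor
      · linarith [hmono hs.1]
      · linarith [hmono hs.2]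
    have hnhds : S ∈ 𝓝 (s, z + r s) := by
      have n1 : Icc 0 h ×ˢ Icc (0 : ℝ) 1 ∈ 𝓝 (s, z + r s) :=
        prod_mem_nhds (Icc_mem_nhds hs'.1 hs'.2) (Icc_mem_nhds hx.1 hx.2)
      have n2 : ∀ᶠ p : ℝ × ℝ in 𝓝 (s, z + r s), p.2 - r p.1 ∈ Nᶜ := by
        have hc : ContinuousAt (fun p : ℝ × ℝ => p.2 - r p.1) (s, z + r s) := by fun_prop
        refine hc.eventually_mem (hNf.isClosed.isOpen_compl.mem_nhds ?_)
        simpa using hzN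
      filter_upwards [n1, n2] with p hp hp'
      exact hmem p.1 hp.1 p.2 hp.2 hp'
    have hY : HasFDerivAt (fun p : ℝ × ℝ => y p.1 p.2)
        (fderiv ℝ (fun p : ℝ × ℝ => y p.1 p.2) (s, z + r s)) (s, z + r s) :=
      ((hy.regular.contDiffAt hnhds).differentiableAt (by simp)).hasFDerivAt
    set L := fderiv ℝ (fun p : ℝ × ℝ => y p.1 p.2) (s, z + r s)
    have d1 : HasDerivAt (fun s' => y s' (z + r s)) (L (1, 0)) s :=
      hY.comp_hasDerivAt (f := fun s' : ℝ => (s', z + r s)) s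
        ((hasDerivAt_id s).prodMk (hasDerivAt_const s (z + r s)))
    have d2 : HasDerivAt (fun x => y s x) (L (0, 1)) (z + r s) :=
      hY.comp_hasDerivAt (f := fun x : ℝ => (s, x)) (z + r s)
        ((hasDerivAt_const (z + r s) s).prodMk (hasDerivAt_id (z + r s)))
    have d3 : HasDerivAt (fun s' => y s' (z + r s')) (L (1, w s)) s :=
      hY.comp_hasDerivAt (f := fun s' : ℝ => (s', z + r s')) s
        ((hasDerivAt_id s).prodMk ((hr s).const_add z))
    have hp := hy.pde s (z + r s) (mem_of_mem_nhds hnhds)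
    rw [derivWithin_of_mem_nhds (Icc_mem_nhds hs'.1 hs'.2),
      derivWithin_of_mem_nhds (Icc_mem_nhds hx.1 hx.2), d1.deriv, d2.deriv,
      ← hwv s (Ioo_subset_Icc_self hs')] at hp
    refine d3.congr_deriv ?_
    have : ((1, w s) : ℝ × ℝ) = (1, 0) + w s • (0, 1) := by simp
    rw [this, map_add, map_smul, smul_eq_mul, hp]
  obtain ⟨c, hc, hce⟩ := exists_hasDerivAt_eq_slope (fun s => y s (z + r s)) (fun _ => 0) hlt hφc hφd
  have : (s₁ - s₀) ≠ 0 := (sub_pos.2 hlt).ne'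
  rw [eq_comm, div_eq_zero_iff] at hce
  rcases hce with hce | hce
  · linarith
  · exact absurd hce this

/-- As long as nothing that enters can leave again (`lam 0 * h < 1`), a solution is the translate by
`r t` of one profile, where the displacement `r` solves a scalar differential equation whose
right-hand side involves the data only, through `work f + u * t - outflow f (r t)`. -/
theorem IsConstInputSolution.exists_representation (hy : IsConstInputSolution lam u f h y)
    (hlam : ContinuousOn lam (Ici 0)) (hpos : ∀ s, 0 ≤ s → 0 < lam s)
    (hanti : AntitoneOn lam (Ici 0)) (hf : IsPC1 f) (hh : 0 ≤ h) (hh1 : lam 0 * h < 1) :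
    ∃ r : ℝ → ℝ, r 0 = 0 ∧ StrictMono r ∧
      (∀ t ∈ Icc 0 h, r t ∈ Ico 0 1) ∧
      (∀ t ∈ Icc 0 h, HasDerivAt r (lam (work (y t))) t) ∧
      (∀ t ∈ Icc 0 h, work (y t) = work f + u * t - outflow f (r t)) ∧
      (∀ t ∈ Icc 0 h, ∀ x ∈ Icc (0 : ℝ) 1, (r t < x → y t x = f (x - r t)) ∧
        (x ≤ r t → ∃ s ∈ Icc 0 t, r s = r t - x ∧ y t x = u / lam (work (y s)))) := by
  have hv : ContinuousOn (fun t => lam (work (y t))) (Icc 0 h) :=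
    hlam.comp hy.work_cont fun t ht => (hy.work_pos ht).le
  obtain ⟨w, r, q, hw, hwpos, hwv, hrd, hr0, hmono, hqmono, hrv, hqr, hrq, hqc, hq⟩ :=
    exists_travelTime hh hv fun t ht => hpos _ (hy.work_pos ht).le
  have hr1 : ∀ t ∈ Icc 0 h, r t ∈ Ico 0 1 := by
    intro t ht
    refine ⟨hr0 ▸ hmono.monotone ht.1, ?_⟩
    have h1 := intervalIntegral.norm_integral_le_of_norm_le_const (a := 0) (b := t)
      (f := fun t => lam (work (y t))) (C := lam 0) (fun s hs => by
        rw [uIoc_of_le ht.1] at hs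
        have h2 := hy.work_pos (t := s) ⟨hs.1.le, hs.2.trans ht.2⟩
        rw [Real.norm_of_nonneg (hpos _ h2.le).le]
        exact hanti (mem_Ici.2 le_rfl) h2.le h2.le)
    rw [← hrv t ht, sub_zero, abs_of_nonneg ht.1, Real.norm_eq_abs] at h1
    have h3 : lam 0 * t ≤ lam 0 * h := mul_le_mul_of_nonneg_left ht.2 (hpos 0 le_rfl).le
    linarith [le_abs_self (r t)]
  have hq0 : q 0 = 0 := by simpa [hr0] using hqr 0
  set G := inflowProfile u f w q with hG
  have hbd : ∀ t ∈ Icc 0 h, y t 0 = u / w t := by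
    intro t ht
    rw [eq_div_iff (hwpos t).ne', hwv ht]
    exact hy.boundary t ht
  have hgen : ∀ t ∈ Icc 0 h, ∀ x ∈ Icc (0 : ℝ) 1, x - r t ∉ breakPoints f →
      x - r t + 1 ∉ breakPoints f → y t x = G (x - r t) := by
    intro t ht x hx hz hz'
    set z := x - r t with hzdef
    have hxz : x = z + r t := by ring
    -- trace the characteristic back to the initial time or to the inlet
    rcases lt_or_ge 0 z with h0 | h0
    · have := hy.eq_along_characteristic hf hrd hmono hwv hrv hz hz' le_rfl ht.1 ht.2
        (by rw [hr0]; linarith) (by linarith [hx.2])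
      rw [hxz, this, hr0, add_zero, hG]
      simp only [inflowProfile, h0, if_true]
      refine hy.initial z ⟨h0, ?_⟩
      linarith [(hr1 t ht).1, hx.2]
    · have hs0 : 0 ≤ q (-z) := hq0 ▸ hqmono.monotone (by linarith)
      have hst : q (-z) ≤ t := by
        rw [← hqr t]
        exact hqmono.monotone (by linarith [hx.1])
      have := hy.eq_along_characteristic hf hrd hmono hwv hrv hz hz' hs0 hst ht.2
        (by rw [hrq]; linarith) (by linarith [hx.2])
      rw [hxz, this, hrq, add_neg_cancel, hbd _ ⟨hs0, hst.trans ht.2⟩, hG]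
      simp only [inflowProfile, not_lt.2 h0, if_false]
  have hrep : ∀ t ∈ Icc 0 h, ∀ x ∈ Icc (0 : ℝ) 1, y t x = G (x - r t) := by
    intro t ht x hx
    rcases hx.1.eq_or_lt with rfl | hx0
    · rw [hbd t ht, hG]
      have : ¬ 0 < -r t := by linarith [(hr1 t ht).1]
      simp only [inflowProfile, this, if_false, zero_sub, neg_neg, hqr]
    · -- both sides are left-continuous in `x` and agree off a finite set
      have hN := (eventually_notMem_of_finite hf.finite_breakPoints (x - r t)).and
        (eventually_notMem_of_finite (hf.finite_breakPoints.preimage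
          (f := fun ξ => ξ + 1) (add_left_injective _).injOn) (x - r t))
      have ht1 := tendsto_sub_nhdsLT (r t) x
      have l2 : Tendsto (fun x' => G (x' - r t)) (𝓝[<] x) (𝓝 (G (x - r t))) :=
        (tendsto_inflowProfile_left hf hw hwpos hqc (by linarith [(hr1 t ht).1, hx.2])).comp ht1
      have hev := ht1.eventually (hN.filter_mono (nhdsWithin_mono _ fun a ha => ne_of_lt ha))
      refine tendsto_nhds_unique ((hy.pc1 t ht).left_cont x ⟨hx0, hx.2⟩) (l2.congr' ?_)
      filter_upwards [hev, Ioo_mem_nhdsLT hx0] with x' hx' hx''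
      exact (hgen t ht x' ⟨hx''.1.le, hx''.2.le.trans hx.2⟩ hx'.1 hx'.2).symm
  refine ⟨r, hr0, hmono, hr1, ?_, ?_, ?_⟩
  · intro t ht
    have := hrd t
    rwa [hwv ht] at this
  · intro t ht
    rw [← work_inflowProfile hf hw hwpos hr0 hqr hq (hr1 t ht).1 (hr1 t ht).2.le]
    exact work_congr fun x hx => hrep t ht x (Ioc_subset_Icc_self hx)
  · intro t ht x hx
    refine ⟨fun hlt => ?_, fun hle => ?_⟩
    · rw [hrep t ht x hx, hG]
      simp only [inflowProfile, sub_pos.2 hlt, if_true]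
    · have hs0 : 0 ≤ q (r t - x) := hq0 ▸ hqmono.monotone (by linarith)
      have hst : q (r t - x) ≤ t := by
        conv_rhs => rw [← hqr t]
        exact hqmono.monotone (by linarith [hx.1])
      refine ⟨q (r t - x), ⟨hs0, hst⟩, hrq _, ?_⟩
      rw [hrep t ht x hx, hG]
      have : ¬ 0 < x - r t := by linarith
      simp only [inflowProfile, this, if_false, neg_sub]
      rw [hwv ⟨hs0, hst.trans ht.2⟩]

/-- The right-hand side `lam (V₀ + u * t - outflow f x)` of the equation for the displacement, with
the argument of `lam` cut off at `0`. -/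
noncomputable def speedField (lam : ℝ → ℝ) (u : ℝ) (f : ℝ → ℝ) (t x : ℝ) : ℝ :=
  lam (max 0 (work f + u * t - outflow f x))

/-- The outflow is Lipschitz in the displacement because profiles are bounded; this makes the problem
well posed although the profile itself may jump. -/
theorem lipschitzWith_speedField {K M : ℝ} (hK : 0 ≤ K)
    (hL : ∀ a b, 0 ≤ a → 0 ≤ b → |lam a - lam b| ≤ K * |a - b|) (hf : IsPC1 f)
    (hM : 0 ≤ M) (hfM : ∀ x ∈ Ioc (0 : ℝ) 1, |f x| ≤ M) (t : ℝ) :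
    LipschitzWith (Real.toNNReal (K * M)) (speedField lam u f t) := by
  refine LipschitzWith.of_dist_le_mul fun a b => ?_
  rw [Real.dist_eq, Real.dist_eq, Real.coe_toNNReal _ (mul_nonneg hK hM), mul_assoc]
  refine (hL _ _ (le_max_left _ _) (le_max_left _ _)).trans (mul_le_mul_of_nonneg_left ?_ hK)
  refine (abs_max_sub_max_le_max _ _ _ _).trans ?_
  rw [sub_self, abs_zero, max_eq_right (abs_nonneg _), abs_sub_comm]
  have := hf.abs_outflow_sub_le hfM a b
  rwa [sub_sub_sub_cancel_left]

/-- Uniqueness for the constant-input problem; the initial profiles need to agree on `(0,1]` only. -/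
theorem IsConstInputSolution.unique {f' : ℝ → ℝ} {y' : ℝ → ℝ → ℝ} {K : ℝ}
    (hy : IsConstInputSolution lam u f h y) (hy' : IsConstInputSolution lam u f' h y')
    (hlam : ContinuousOn lam (Ici 0)) (hpos : ∀ s, 0 ≤ s → 0 < lam s)
    (hanti : AntitoneOn lam (Ici 0)) (hK : 0 ≤ K)
    (hL : ∀ a b, 0 ≤ a → 0 ≤ b → |lam a - lam b| ≤ K * |a - b|)
    (hf : IsPC1 f) (hff' : EqOn f f' (Ioc 0 1)) (hh : 0 ≤ h) (hh1 : lam 0 * h < 1) :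
    ∀ t ∈ Icc 0 h, ∀ x ∈ Icc (0 : ℝ) 1, y' t x = y t x := by
  obtain ⟨r, hr0, hmono, hr1, hrd, hV, hrep⟩ := hy.exists_representation hlam hpos hanti hf hh hh1
  obtain ⟨r', hr0', hmono', hr1', hrd', hV', hrep'⟩ :=
    hy'.exists_representation hlam hpos hanti (hf.congr hff') hh hh1
  obtain ⟨M, hM, hfM⟩ := hf.exists_bound
  have ho : outflow f' = outflow f := by
    funext x; rw [outflow, outflow, profileExt_congr hff']
  have hd : ∀ t ∈ Icc 0 h, HasDerivAt r (speedField lam u f t (r t)) t := by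
    intro t ht
    have := hrd t ht
    rwa [← max_eq_right (hy.work_pos ht).le, hV t ht] at this
  have hd' : ∀ t ∈ Icc 0 h, HasDerivAt r' (speedField lam u f t (r' t)) t := by
    intro t ht
    have := hrd' t ht
    rwa [← max_eq_right (hy'.work_pos ht).le, hV' t ht, ho, ← work_congr hff'] at this
  have hrr : EqOn r r' (Icc 0 h) :=
    ODE_solution_unique (fun t => lipschitzWith_speedField hK hL hf hM.le hfM t)
      (fun t ht => (hd t ht).continuousAt.continuousWithinAt)
      (fun t ht => (hd t (Ico_subset_Icc_self ht)).hasDerivWithinAt)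
      (fun t ht => (hd' t ht).continuousAt.continuousWithinAt)
      (fun t ht => (hd' t (Ico_subset_Icc_self ht)).hasDerivWithinAt) (hr0.trans hr0'.symm)
  have hVV : ∀ t ∈ Icc 0 h, work (y' t) = work (y t) := fun t ht => by
    rw [hV t ht, hV' t ht, ho, ← work_congr hff', hrr ht]
  intro t ht x hx
  rcases lt_or_ge (r t) x with hlt | hle
  · rw [(hrep t ht x hx).1 hlt, (hrep' t ht x hx).1 (hrr ht ▸ hlt), ← hrr ht]
    exact (hff' ⟨by linarith, by linarith [(hr1 t ht).1, hx.2]⟩).symm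
  · obtain ⟨s, hs, hs1, hs2⟩ := (hrep t ht x hx).2 hle
    obtain ⟨s', hs', hs1', hs2'⟩ := (hrep' t ht x hx).2 (hrr ht ▸ hle)
    have hsh : s ∈ Icc 0 h := ⟨hs.1, hs.2.trans ht.2⟩
    have hsh' : s' ∈ Icc 0 h := ⟨hs'.1, hs'.2.trans ht.2⟩
    have : s' = s := hmono.injective (by rw [hrr hsh', hs1', hs1, hrr ht])
    rw [hs2, hs2', this, hVV s hsh]

end Representation

/-! ### Existence for the constant-input problem -/

/-- All conditions in `IsPC1` are local and translation invariant, so the translates of `G` inherit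
them from `G` on the window `[-b, 1 - b]`. -/
theorem isPC1_translate {G : ℝ → ℝ} {b : ℝ}
    (hl : ∀ z ∈ Ioc (-b) (1 - b), Tendsto G (𝓝[<] z) (𝓝 (G z)))
    (hr : ∀ z ∈ Ico (-b) (1 - b), ∃ l, Tendsto G (𝓝[>] z) (𝓝 l))
    (hrs : ∀ z ∈ Ico (-b) (1 - b), ∃ l,
      Tendsto (fun p : ℝ × ℝ => p.1⁻¹ * (G (p.2 + p.1) - G p.2)) (𝓝[>] 0 ×ˢ 𝓝[>] z) (𝓝 l))
    (hls : ∀ z ∈ Ioc (-b) (1 - b), ∃ l,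
      Tendsto (fun h : ℝ => h⁻¹ * (G (z + h) - G z)) (𝓝[<] 0) (𝓝 l))
    (hJ : ∃ J : Set ℝ, J.Finite ∧ ∀ z ∈ Ioo (-b) (1 - b) \ J, ContDiffAt ℝ 1 G z) :
    IsPC1 fun x => G (x - b) := by
  refine ⟨?_, ?_, ?_, ?_, ?_⟩
  · intro x hx
    exact (hl (x - b) ⟨by linarith [hx.1], by linarith [hx.2]⟩).comp (tendsto_sub_nhdsLT b x)
  · intro x hx
    obtain ⟨l, h⟩ := hr (x - b) ⟨by linarith [hx.1], by linarith [hx.2]⟩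
    exact ⟨l, h.comp (tendsto_sub_nhdsGT b x)⟩
  · intro x hx
    obtain ⟨l, h⟩ := hrs (x - b) ⟨by linarith [hx.1], by linarith [hx.2]⟩
    refine ⟨l, (h.comp ((tendsto_id (x := 𝓝[>] (0 : ℝ))).prodMap (tendsto_sub_nhdsGT b x))).congr ?_⟩
    intro p
    change p.1⁻¹ * (G (p.2 - b + p.1) - G (p.2 - b)) = _
    rw [sub_add_eq_add_sub]
  · intro x hx
    obtain ⟨l, h⟩ := hls (x - b) ⟨by linarith [hx.1], by linarith [hx.2]⟩
    refine ⟨l, h.congr fun p => ?_⟩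
    rw [sub_add_eq_add_sub]
  · obtain ⟨J, hJ, h⟩ := hJ
    have hc : ∀ x ∈ Ioo (0 : ℝ) 1 \ ((fun x => x - b) ⁻¹' J ∩ Ioo 0 1),
        ContDiffAt ℝ 1 (fun x => G (x - b)) x := by
      intro x hx
      have h1 := h (x - b) ⟨⟨by linarith [hx.1.1], by linarith [hx.1.2]⟩,
        fun hJx => hx.2 ⟨hJx, hx.1⟩⟩
      exact h1.comp x (f := fun x => x - b) (by fun_prop)
    refine ⟨(fun x => x - b) ⁻¹' J ∩ Ioo 0 1, inter_subset_right,
      (hJ.preimage (sub_left_injective).injOn).inter_of_left _, ?_, ?_⟩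
    · intro x hx
      exact (hc x hx).differentiableAt (by simp)
    · intro x hx
      exact (continuousAt_deriv_of_contDiffAt (hc x hx)).continuousWithinAt

theorem IsPC1.eventually_continuousAt_left {f : ℝ → ℝ} (hf : IsPC1 f) {x : ℝ}
    (hx : x ∈ Ioc (0 : ℝ) 1) : ∀ᶠ w in 𝓝[<] x, ContinuousAt (profileExt f) w := by
  obtain ⟨J, hJ, h⟩ := hf.exists_finite_contDiffAt
  filter_upwards [(eventually_notMem_of_finite hJ x).filter_mono
    (nhdsWithin_mono x fun a ha => ne_of_lt ha), Ioo_mem_nhdsLT hx.1] with w hw hw'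
  have hw1 : w ∈ Ioo (0 : ℝ) 1 := ⟨hw'.1, hw'.2.trans_le hx.2⟩
  exact (h w ⟨hw1, hw⟩).continuousAt.congr (profileExt_eventuallyEq hw1).symm

theorem IsPC1.eventually_continuousAt_right {f : ℝ → ℝ} (hf : IsPC1 f) {x : ℝ}
    (hx : x ∈ Ico (0 : ℝ) 1) : ∀ᶠ w in 𝓝[>] x, ContinuousAt (profileExt f) w := by
  obtain ⟨J, hJ, h⟩ := hf.exists_finite_contDiffAt
  filter_upwards [(eventually_notMem_of_finite hJ x).filter_mono
    (nhdsWithin_mono x fun a ha => ne_of_gt ha), Ioo_mem_nhdsGT hx.2] with w hw hw'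
  have hw1 : w ∈ Ioo (0 : ℝ) 1 := ⟨hx.1.trans_lt hw'.1, hw'.2⟩
  exact (h w ⟨hw1, hw⟩).continuousAt.congr (profileExt_eventuallyEq hw1).symm

section InflowDensity

variable {lam : ℝ → ℝ} {u : ℝ} {f q q' : ℝ → ℝ}

/-- The content of the interval at the time `q p` at which the displacement equals `p`. -/
noncomputable def contentAt (u : ℝ) (f q : ℝ → ℝ) (p : ℝ) : ℝ :=
  work f + u * q p - outflow f p

/-- The density, in the coordinate of the initial profile, of what enters at the time `q (-z)`. -/
noncomputable def inflowDensity (lam : ℝ → ℝ) (u : ℝ) (f q : ℝ → ℝ) (z : ℝ) : ℝ :=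
  u / lam (contentAt u f q (-z))

/-- The derivative of `inflowDensity` as a function of the point `z` and of the value `p` of the
initial density at `1 + z`, the density that leaves while the matter at `z` enters. -/
noncomputable def inflowSlope (lam : ℝ → ℝ) (u : ℝ) (f q q' : ℝ → ℝ) (z p : ℝ) : ℝ :=
  -(u * (deriv lam (contentAt u f q (-z)) * (p - u * q' (-z)))) / lam (contentAt u f q (-z)) ^ 2

theorem IsPC1.continuous_contentAt (hf : IsPC1 f) (hq : Continuous q) :
    Continuous (contentAt u f q) := by
  have := hf.continuous_outflow
  unfold contentAt
  fun_prop

theorem hasDerivAt_inflowDensity (hlam : ContDiffOn ℝ 1 lam (Ici 0))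
    (hpos : ∀ s, 0 ≤ s → 0 < lam s) (hf : IsPC1 f) (hq : ∀ p, HasDerivAt q (q' p) p) {z : ℝ}
    (hz : 0 < contentAt u f q (-z)) (hc : ContinuousAt (profileExt f) (1 + z)) :
    HasDerivAt (inflowDensity lam u f q) (inflowSlope lam u f q q' z (profileExt f (1 + z))) z := by
  have h1 : HasDerivAt lam (deriv lam (contentAt u f q (-z))) (contentAt u f q (-z)) :=
    ((hlam.contDiffAt (Ici_mem_nhds hz)).differentiableAt (by simp)).hasDerivAt
  have hc' : ContinuousAt (profileExt f) (1 - -z) := by rwa [sub_neg_eq_add]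
  have h2 : HasDerivAt (contentAt u f q) (u * q' (-z) - profileExt f (1 - -z)) (-z) :=
    (((hq (-z)).const_mul u).const_add (work f)).sub (hf.hasDerivAt_outflow hc')
  have h3 := h1.comp z (h2.comp z (hasDerivAt_neg z))
  have h4 := (hasDerivAt_const z u).div h3 (hpos _ hz.le).ne'
  refine h4.congr_deriv ?_
  simp only [inflowSlope, Function.comp_apply, sub_neg_eq_add]
  ring

theorem tendsto_inflowSlope (hlam : ContDiffOn ℝ 1 lam (Ici 0))
    (hpos : ∀ s, 0 ≤ s → 0 < lam s) (hf : IsPC1 f) (hq : Continuous q) (hq' : Continuous q')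
    {z p : ℝ} (hz : 0 < contentAt u f q (-z)) {l : Filter ℝ} (hl : l ≤ 𝓝 z)
    (hp : Tendsto (fun w => profileExt f (1 + w)) l (𝓝 p)) :
    Tendsto (fun w => inflowSlope lam u f q q' w (profileExt f (1 + w))) l
      (𝓝 (inflowSlope lam u f q q' z p)) := by
  have hlz := hlam.contDiffAt (Ici_mem_nhds hz)
  have hcz : Tendsto (fun w => contentAt u f q (-w)) l (𝓝 (contentAt u f q (-z))) :=
    (((hf.continuous_contentAt hq).comp continuous_neg).tendsto z).mono_left hl
  have h1 := (continuousAt_deriv_of_contDiffAt hlz).tendsto.comp hcz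
  have h2 := hlz.continuousAt.tendsto.comp hcz
  have h3 : Tendsto (fun w => q' (-w)) l (𝓝 (q' (-z))) :=
    ((hq'.comp continuous_neg).tendsto z).mono_left hl
  exact (((h1.mul (hp.sub (h3.const_mul u))).const_mul u).neg).div (h2.pow 2)
    (pow_ne_zero 2 (hpos _ hz.le).ne')

theorem contDiffAt_inflowDensity (hlam : ContDiffOn ℝ 1 lam (Ici 0))
    (hpos : ∀ s, 0 ≤ s → 0 < lam s) (hf : IsPC1 f) (hq : ∀ p, HasDerivAt q (q' p) p)
    (hq' : Continuous q') {z : ℝ}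
    (hz : 0 < contentAt u f q (-z)) (hc : ∀ᶠ x in 𝓝 (1 + z), ContinuousAt (profileExt f) x) :
    ContDiffAt ℝ 1 (inflowDensity lam u f q) z := by
  have hqc : Continuous q := continuous_iff_continuousAt.2 fun z => (hq z).continuousAt
  have e1 : ∀ᶠ w in 𝓝 z, 0 < contentAt u f q (-w) :=
    ((hf.continuous_contentAt hqc).comp continuous_neg).continuousAt.eventually (Ioi_mem_nhds hz)
  have e2 : ∀ᶠ w in 𝓝 z, ContinuousAt (profileExt f) (1 + w) :=
    (Continuous.tendsto (by fun_prop : Continuous fun w : ℝ => 1 + w) z).eventually hc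
  refine contDiffAt_one_of_hasDerivAt
    (g' := fun w => inflowSlope lam u f q q' w (profileExt f (1 + w))) ?_ ?_
  · filter_upwards [e1, e2] with w h1 h2 using hasDerivAt_inflowDensity hlam hpos hf hq h1 h2
  · filter_upwards [e1, e2] with w h1 h2
    exact tendsto_inflowSlope hlam hpos hf hqc hq' h1 le_rfl
      (ContinuousAt.comp (f := fun w : ℝ => 1 + w) h2 (by fun_prop)).tendsto

theorem continuousAt_inflowDensity (hlam : ContDiffOn ℝ 1 lam (Ici 0))
    (hpos : ∀ s, 0 ≤ s → 0 < lam s) (hf : IsPC1 f) (hq : Continuous q) {z : ℝ}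
    (hz : 0 < contentAt u f q (-z)) : ContinuousAt (inflowDensity lam u f q) z := by
  have h2 : ContinuousAt (fun w => lam (contentAt u f q (-w))) z :=
    ContinuousAt.comp (g := lam) (hlam.contDiffAt (Ici_mem_nhds hz)).continuousAt
      ((hf.continuous_contentAt hq).comp continuous_neg).continuousAt
  exact continuousAt_const.div h2 (hpos _ hz.le).ne'

theorem tendsto_leftSlope_inflowDensity (hlam : ContDiffOn ℝ 1 lam (Ici 0))
    (hpos : ∀ s, 0 ≤ s → 0 < lam s) (hf : IsPC1 f) (hq : ∀ p, HasDerivAt q (q' p) p)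
    (hq' : Continuous q') {z : ℝ} (hz : 0 < contentAt u f q (-z)) (hz' : z ∈ Ioc (-1 : ℝ) 0) :
    ∃ l, Tendsto (fun h : ℝ => h⁻¹ * (inflowDensity lam u f q (z + h) - inflowDensity lam u f q z))
      (𝓝[<] 0) (𝓝 l) := by
  have hqc : Continuous q := continuous_iff_continuousAt.2 fun z => (hq z).continuousAt
  have hx : 1 + z ∈ Ioc (0 : ℝ) 1 := ⟨by linarith [hz'.1], by linarith [hz'.2]⟩
  have e1 : ∀ᶠ w in 𝓝 z, 0 < contentAt u f q (-w) :=
    ((hf.continuous_contentAt hqc).comp continuous_neg).continuousAt.eventually (Ioi_mem_nhds hz)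
  have ht : Tendsto (fun w : ℝ => 1 + w) (𝓝[<] z) (𝓝[<] (1 + z)) := by
    simpa [sub_neg_eq_add, add_comm] using tendsto_sub_nhdsLT (-1) z
  have hp : Tendsto (profileExt f) (𝓝[<] (1 + z)) (𝓝 (f (1 + z))) := by
    refine (hf.left_cont _ hx).congr' ?_
    filter_upwards [Ioo_mem_nhdsLT hx.1] with w hw
    exact (profileExt_of_mem ⟨hw.1, hw.2.le.trans hx.2⟩).symm
  refine ⟨_, tendsto_leftSlope_of_deriv (continuousAt_inflowDensity hlam hpos hf hqc hz) ?_
    (tendsto_inflowSlope hlam hpos hf hqc hq' hz nhdsWithin_le_nhds (hp.comp ht))⟩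
  filter_upwards [e1.filter_mono nhdsWithin_le_nhds,
    ht.eventually (hf.eventually_continuousAt_left hx)] with w h1 h2
  exact hasDerivAt_inflowDensity hlam hpos hf hq h1 h2

theorem tendsto_rightSlope_inflowDensity (hlam : ContDiffOn ℝ 1 lam (Ici 0))
    (hpos : ∀ s, 0 ≤ s → 0 < lam s) (hf : IsPC1 f) (hq : ∀ p, HasDerivAt q (q' p) p)
    (hq' : Continuous q') {z : ℝ} (hz : 0 < contentAt u f q (-z)) (hz' : z ∈ Ico (-1 : ℝ) 0) :
    ∃ l, Tendsto (fun p : ℝ × ℝ => p.1⁻¹ *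
      (inflowDensity lam u f q (p.2 + p.1) - inflowDensity lam u f q p.2))
      (𝓝[>] 0 ×ˢ 𝓝[>] z) (𝓝 l) := by
  have hqc : Continuous q := continuous_iff_continuousAt.2 fun z => (hq z).continuousAt
  have hx : 1 + z ∈ Ico (0 : ℝ) 1 := ⟨by linarith [hz'.1], by linarith [hz'.2]⟩
  have e1 : ∀ᶠ w in 𝓝 z, 0 < contentAt u f q (-w) :=
    ((hf.continuous_contentAt hqc).comp continuous_neg).continuousAt.eventually (Ioi_mem_nhds hz)
  have ht : Tendsto (fun w : ℝ => 1 + w) (𝓝[>] z) (𝓝[>] (1 + z)) := by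
    simpa [sub_neg_eq_add, add_comm] using tendsto_sub_nhdsGT (-1) z
  obtain ⟨l, hl⟩ := hf.right_lim _ hx
  have hp : Tendsto (profileExt f) (𝓝[>] (1 + z)) (𝓝 l) := by
    refine hl.congr' ?_
    filter_upwards [Ioo_mem_nhdsGT hx.2] with w hw
    exact (profileExt_of_mem ⟨hx.1.trans_lt hw.1, hw.2.le⟩).symm
  refine ⟨_, tendsto_rightSlope_of_deriv ?_
    (tendsto_inflowSlope hlam hpos hf hqc hq' hz nhdsWithin_le_nhds (hp.comp ht))⟩
  filter_upwards [e1.filter_mono nhdsWithin_le_nhds,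
    ht.eventually (hf.eventually_continuousAt_right hx)] with w h1 h2
  exact hasDerivAt_inflowDensity hlam hpos hf hq h1 h2

end InflowDensity

section Existence

variable {lam : ℝ → ℝ} {u h K : ℝ} {f : ℝ → ℝ}

/-- The displacement of a solution with constant input, obtained from the Picard–Lindelöf theorem: its
speed is bounded by `lam 0`, so on `[0,h]` the displacement stays below `1`. There the content is
positive and the cut-off in `speedField` is not active. -/
theorem exists_displacement (hlam : ContinuousOn lam (Ici 0)) (hpos : ∀ s, 0 ≤ s → 0 < lam s)
    (hanti : AntitoneOn lam (Ici 0)) (hK : 0 ≤ K)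
    (hL : ∀ a b, 0 ≤ a → 0 ≤ b → |lam a - lam b| ≤ K * |a - b|)
    (hf : IsPC1 f) (hfp : ∀ x ∈ Ioc (0 : ℝ) 1, 0 < f x) (hu : 0 ≤ u) (hh : 0 ≤ h)
    (hh1 : lam 0 * h < 1) :
    ∃ w r q : ℝ → ℝ, Continuous w ∧ (∀ t, 0 < w t) ∧
      (∀ t, HasDerivAt r (w t) t) ∧ r 0 = 0 ∧ StrictMono r ∧ StrictMono q ∧
      (∀ t, q (r t) = t) ∧ (∀ z, r (q z) = z) ∧ Continuous q ∧
      (∀ z, HasDerivAt q (w (q z))⁻¹ z) ∧ (∀ t ∈ Icc 0 h, r t ∈ Ico 0 1) ∧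
      (∀ t ∈ Icc 0 h, 0 < work f + u * t - outflow f (r t) ∧
        w t = lam (work f + u * t - outflow f (r t))) := by
  obtain ⟨M, hM, hfM⟩ := hf.exists_bound
  have hl0 := hpos 0 le_rfl
  have hFc : Continuous fun p : ℝ × ℝ => speedField lam u f p.1 p.2 := by
    have h1 : Continuous fun p : ℝ × ℝ => max 0 (work f + u * p.1 - outflow f p.2) := by
      have := hf.continuous_outflow
      fun_prop
    exact hlam.comp_continuous h1 fun p => mem_Ici.2 (le_max_left _ _)
  have hFpos : ∀ t x, 0 < speedField lam u f t x := fun t x => hpos _ (le_max_left _ _)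
  have hFle : ∀ t x, speedField lam u f t x ≤ lam 0 := fun t x =>
    hanti (mem_Ici.2 le_rfl) (mem_Ici.2 (le_max_left _ _)) (le_max_left _ _)
  have hPL : IsPicardLindelof (speedField lam u f) (tmin := 0) (tmax := h) ⟨0, le_rfl, hh⟩ (0 : ℝ)
      1 0 (Real.toNNReal (lam 0)) (Real.toNNReal (K * M)) := by
    refine ⟨fun t _ => (lipschitzWith_speedField hK hL hf hM.le hfM t).lipschitzOnWith, ?_, ?_, ?_⟩
    · intro x _
      exact (hFc.comp (by fun_prop : Continuous fun t : ℝ => (t, x))).continuousOn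
    · intro t _ x _
      rw [Real.norm_of_nonneg (hFpos t x).le, Real.coe_toNNReal _ hl0.le]
      exact hFle t x
    · rw [Real.coe_toNNReal _ hl0.le]
      simp only [sub_zero, sub_self, max_eq_left hh, NNReal.coe_one, NNReal.coe_zero]
      exact hh1.le
  obtain ⟨ρ, hρ0, hρ⟩ := hPL.exists_eq_forall_mem_Icc_hasDerivWithinAt₀
  have hρc : ContinuousOn ρ (Icc 0 h) := fun t ht => (hρ t ht).continuousWithinAt
  have hv : ContinuousOn (fun t => speedField lam u f t (ρ t)) (Icc 0 h) :=
    hFc.comp_continuousOn (continuousOn_id.prodMk hρc)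
  obtain ⟨w, r, q, hw, hwpos, hwv, hrd, hr0, hmono, hqmono, hrv, hqr, hrq, hqc, hq⟩ :=
    exists_travelTime hh hv fun t _ => hFpos _ _
  have hrρ : ∀ t ∈ Icc 0 h, r t = ρ t := by
    intro t ht
    have hsub : Icc 0 t ⊆ Icc 0 h := Icc_subset_Icc_right ht.2
    rw [hrv t ht, intervalIntegral.integral_eq_sub_of_hasDerivAt_of_le ht.1 (hρc.mono hsub)
      (fun s hs => (hρ s (hsub (Ioo_subset_Icc_self hs))).hasDerivAt
        (Icc_mem_nhds hs.1 (hs.2.trans_le ht.2)))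
      ((hv.mono hsub).intervalIntegrable_of_Icc ht.1)]
    have : ρ 0 = 0 := hρ0
    rw [this, sub_zero]
  have hr1 : ∀ t ∈ Icc 0 h, r t ∈ Ico 0 1 := by
    intro t ht
    refine ⟨hr0 ▸ hmono.monotone ht.1, ?_⟩
    have h1 := intervalIntegral.norm_integral_le_of_norm_le_const (a := 0) (b := t)
      (f := fun t => speedField lam u f t (ρ t)) (C := lam 0) (fun s _ => by
        rw [Real.norm_of_nonneg (hFpos _ _).le]
        exact hFle _ _)
    rw [← hrv t ht, sub_zero, abs_of_nonneg ht.1, Real.norm_eq_abs] at h1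
    have h3 : lam 0 * t ≤ lam 0 * h := mul_le_mul_of_nonneg_left ht.2 hl0.le
    linarith [le_abs_self (r t)]
  refine ⟨w, r, q, hw, hwpos, hrd, hr0, hmono, hqmono, hqr, hrq, hqc, hq, hr1, ?_⟩
  intro t ht
  have hVpos : 0 < work f + u * t - outflow f (r t) := by
    have h1 : 0 < ∫ x in (0 : ℝ)..(1 - r t), profileExt f x := by
      refine intervalIntegral.intervalIntegral_pos_of_pos_on
        (hf.intervalIntegrable_profileExt _ _) (fun x hx => ?_) (by linarith [(hr1 t ht).2])
      have hx1 : x ∈ Ioc (0 : ℝ) 1 := ⟨hx.1, by linarith [hx.2, (hr1 t ht).1]⟩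
      rw [profileExt_of_mem hx1]
      exact hfp x hx1
    rw [← hf.work_sub_outflow] at h1
    have := mul_nonneg hu ht.1
    linarith
  refine ⟨hVpos, ?_⟩
  rw [hwv ht]
  simp only [speedField]
  rw [← hrρ t ht, max_eq_right hVpos.le]

/-- Existence for the constant-input problem. The solution is `G (x - r t)`; regularity, the
differential equation and membership in `PC¹` are all read off from the regularity of `G` on the
window `[-r h, 1]`. A point `z < 0` of that window is singular only if the initial profile is
singular at `z + 1`: the matter at `z` enters while the matter at `z + 1` leaves, so these are the
characteristics in the second part of `singularSet`. -/
theorem exists_isConstInputSolution (hlam : ContDiffOn ℝ 1 lam (Ici 0))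
    (hpos : ∀ s, 0 ≤ s → 0 < lam s)
    (hanti : AntitoneOn lam (Ici 0)) (hK : 0 ≤ K)
    (hL : ∀ a b, 0 ≤ a → 0 ≤ b → |lam a - lam b| ≤ K * |a - b|)
    (hf : IsPC1 f) {m : ℝ} (hm : 0 < m) (hfm : ∀ x ∈ Ioc (0 : ℝ) 1, m ≤ f x) (hu : 0 < u)
    (hh : 0 < h) (hh1 : lam 0 * h < 1) : ∃ y, IsConstInputSolution lam u f h y := by
  obtain ⟨w, r, q, hw, hwpos, hrd, hr0, hmono, hqmono, hqr, hrq, hqc, hq, hr1, hV⟩ :=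
    exists_displacement hlam.continuousOn hpos hanti hK hL hf (fun x hx => hm.trans_le (hfm x hx))
      hu.le hh.le hh1
  have hrc : Continuous r := continuous_iff_continuousAt.2 fun t => (hrd t).continuousAt
  have hq0 : q 0 = 0 := by simpa [hr0] using hqr 0
  have hq' : Continuous fun z => (w (q z))⁻¹ := (hw.comp hqc).inv₀ fun z => (hwpos _).ne'
  set b := r h with hb
  have hb1 : b < 1 := (hr1 h ⟨hh.le, le_rfl⟩).2
  have hqmem : ∀ z ∈ Icc (-b) 0, q (-z) ∈ Icc 0 h := by
    intro z hz
    constructor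
    · rw [← hq0]; exact hqmono.monotone (by linarith [hz.2])
    · rw [← hqr h]; exact hqmono.monotone (by linarith [hz.1])
  have hCpos : ∀ z ∈ Icc (-b) 0, 0 < contentAt u f q (-z) := by
    intro z hz
    have := (hV _ (hqmem z hz)).1
    rwa [hrq] at this
  set H := inflowDensity lam u f q with hH
  set G := inflowProfile u f w q with hG
  have hGf : ∀ z, 0 < z → G z = f z := fun z hz => by
    rw [hG]; simp only [inflowProfile, hz, if_true]
  have hGw : ∀ z, z ≤ 0 → G z = u / w (q (-z)) := fun z hz => by
    rw [hG]; simp only [inflowProfile, not_lt.2 hz, if_false]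
  have hGH : ∀ z ∈ Icc (-b) 0, G z = H z := by
    intro z hz
    rw [hGw z hz.2, (hV _ (hqmem z hz)).2, hrq]
    rfl
  have hGfr : ∀ z, 0 ≤ z → f =ᶠ[𝓝[>] z] G := fun z hz => by
    filter_upwards [self_mem_nhdsWithin] with x hx
    exact (hGf x (hz.trans_lt hx)).symm
  have hGfl : ∀ z, 0 < z → f =ᶠ[𝓝[<] z] G := fun z hz => by
    filter_upwards [Ioo_mem_nhdsLT hz] with x hx using (hGf x hx.1).symm
  have hHGr : ∀ z ∈ Ico (-b) 0, H =ᶠ[𝓝[>] z] G := fun z hz => by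
    filter_upwards [Ioo_mem_nhdsGT hz.2] with x hx using
      (hGH x ⟨hz.1.trans hx.1.le, hx.2.le⟩).symm
  have hHGl : ∀ z ∈ Ioc (-b) 0, H =ᶠ[𝓝[<] z] G := fun z hz => by
    filter_upwards [Ioo_mem_nhdsLT hz.1] with x hx using
      (hGH x ⟨hx.1.le, hx.2.le.trans hz.2⟩).symm
  -- the profile is `C¹` at every point that lies on no exceptional characteristic
  have hGreg : ∀ z ∈ Icc (-b) 1, z ∉ breakPoints f → (z < 0 → z + 1 ∉ breakPoints f) →
      ContDiffWithinAt ℝ 1 G (Icc (-b) 1) z := by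
    intro z hz hz0 hz1
    have hne : z ≠ 0 := by rintro rfl; exact hz0 (Or.inl rfl)
    rcases lt_or_gt_of_ne hne with hneg | hp
    · have hx : z + 1 ∈ Ioo (0 : ℝ) 1 := ⟨by linarith [hz.1], by linarith⟩
      have h1 : ContDiffAt ℝ 1 f (z + 1) := by
        by_contra hcon
        refine hz1 hneg (Or.inr ⟨Ioo_subset_Icc_self hx, fun hcd => hcon ?_⟩)
        exact hcd.contDiffAt (Icc_mem_nhds hx.1 hx.2)
      have h2 : ∀ᶠ x in 𝓝 (1 + z), ContinuousAt (profileExt f) x := by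
        rw [add_comm]
        filter_upwards [h1.eventually (by simp), Ioo_mem_nhds hx.1 hx.2] with x hx1 hx2
        exact hx1.continuousAt.congr (profileExt_eventuallyEq hx2).symm
      have h3 : ContDiffAt ℝ 1 H z :=
        contDiffAt_inflowDensity hlam hpos hf hq hq' (hCpos z ⟨hz.1, hneg.le⟩) h2
      refine h3.contDiffWithinAt.congr_of_eventuallyEq ?_ (hGH z ⟨hz.1, hneg.le⟩)
      filter_upwards [self_mem_nhdsWithin, mem_nhdsWithin_of_mem_nhds (Iio_mem_nhds hneg)]
        with x hx hx'
      exact hGH x ⟨hx.1, le_of_lt hx'⟩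
    · have h1 : ContDiffWithinAt ℝ 1 f (Icc 0 1) z := by
        by_contra hcon
        exact hz0 (Or.inr ⟨⟨hp.le, hz.2⟩, hcon⟩)
      have h2 : ContDiffWithinAt ℝ 1 f (Icc (-b) 1) z := by
        refine h1.mono_of_mem_nhdsWithin ?_
        filter_upwards [self_mem_nhdsWithin, mem_nhdsWithin_of_mem_nhds (Ioi_mem_nhds hp)]
          with x hx hx'
        exact ⟨le_of_lt hx', hx.2⟩
      refine h2.congr_of_eventuallyEq ?_ (hGf z hp)
      filter_upwards [mem_nhdsWithin_of_mem_nhds (Ioi_mem_nhds hp)] with x hx using hGf x hx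
  have hrle : ∀ t ∈ Icc 0 h, r t ≤ b := fun t ht => hmono.monotone ht.2
  -- one-sided data come from `f` for `z > 0` and from `H` for `z < 0`; at `z = 0` the left ones are
  -- those of `H` and the right ones those of `f`
  have hpc1 : ∀ t ∈ Icc 0 h, IsPC1 fun x => G (x - r t) := by
    intro t ht
    have htb := hrle t ht
    have ht0 := (hr1 t ht).1
    refine isPC1_translate ?_ ?_ ?_ ?_ ?_
    · intro z hz
      exact tendsto_inflowProfile_left hf hw hwpos hqc (by linarith [hz.2])
    · intro z hz
      rcases lt_or_ge z 0 with h0 | h0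
      · have hzb : z ∈ Ico (-b) 0 := ⟨by linarith [hz.1], h0⟩
        have := continuousAt_inflowDensity hlam hpos hf hqc (hCpos z (Ico_subset_Icc_self hzb))
        exact ⟨_, (this.tendsto.mono_left nhdsWithin_le_nhds).congr' (hHGr z hzb)⟩
      · obtain ⟨l, hl⟩ := hf.right_lim z ⟨h0, by linarith [hz.2]⟩
        exact ⟨l, hl.congr' (hGfr z h0)⟩
    · intro z hz
      rcases lt_or_ge z 0 with h0 | h0
      · have hzb : z ∈ Ico (-b) 0 := ⟨by linarith [hz.1], h0⟩
        obtain ⟨l, hl⟩ := tendsto_rightSlope_inflowDensity hlam hpos hf hq hq'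
          (hCpos z (Ico_subset_Icc_self hzb)) ⟨by linarith [hzb.1], h0⟩
        exact ⟨l, tendsto_rightSlope_congr (hHGr z hzb) hl⟩
      · obtain ⟨l, hl⟩ := hf.right_slope z ⟨h0, by linarith [hz.2]⟩
        exact ⟨l, tendsto_rightSlope_congr (hGfr z h0) hl⟩
    · intro z hz
      rcases lt_or_ge 0 z with h0 | h0
      · obtain ⟨l, hl⟩ := hf.left_deriv z ⟨h0, by linarith [hz.2]⟩
        exact ⟨l, tendsto_leftSlope_congr (hGfl z h0) (hGf z h0).symm hl⟩
      · have hzb : z ∈ Ioc (-b) 0 := ⟨by linarith [hz.1], h0⟩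
        obtain ⟨l, hl⟩ := tendsto_leftSlope_inflowDensity hlam hpos hf hq hq'
          (hCpos z (Ioc_subset_Icc_self hzb)) ⟨by linarith [hzb.1], h0⟩
        exact ⟨l, tendsto_leftSlope_congr (hHGl z hzb) (hGH z (Ioc_subset_Icc_self hzb)).symm hl⟩
    · refine ⟨breakPoints f ∪ (fun ξ => ξ + 1) ⁻¹' breakPoints f, hf.finite_breakPoints.union
        (hf.finite_breakPoints.preimage (add_left_injective _).injOn), ?_⟩
      intro z hz
      have hz1 : -b < z := by linarith [hz.1.1]
      have hz2 : z < 1 := by linarith [hz.1.2]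
      exact (hGreg z ⟨hz1.le, hz2.le⟩ (fun hc => hz.2 (Or.inl hc))
        fun _ hc => hz.2 (Or.inr hc)).contDiffAt (Icc_mem_nhds hz1 hz2)
  have hlow : ∀ z ∈ Icc (-b) 1, min m (u / lam 0) ≤ G z := by
    intro z hz
    rcases lt_or_ge 0 z with h0 | h0
    · rw [hGf z h0]
      exact (min_le_left _ _).trans (hfm z ⟨h0, hz.2⟩)
    · rw [hGw z h0]
      refine (min_le_right _ _).trans (div_le_div_of_nonneg_left hu.le (hwpos _) ?_)
      have := hV _ (hqmem z ⟨hz.1, h0⟩)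
      rw [this.2]
      exact hanti (mem_Ici.2 le_rfl) this.1.le this.1.le
  have hlow0 : 0 < min m (u / lam 0) := lt_min hm (div_pos hu (hpos 0 le_rfl))
  have hmap : ∀ t ∈ Icc 0 h, ∀ x ∈ Icc (0 : ℝ) 1, x - r t ∈ Icc (-b) 1 := by
    intro t ht x hx
    exact ⟨by linarith [hrle t ht, hx.1], by linarith [(hr1 t ht).1, hx.2]⟩
  have hwork : ∀ t ∈ Icc 0 h, work (fun x => G (x - r t)) = work f + u * t - outflow f (r t) :=
    fun t ht => work_inflowProfile hf hw hwpos hr0 hqr hq (hr1 t ht).1 (hr1 t ht).2.le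
  have hlamw : ∀ t ∈ Icc 0 h, lam (work (fun x => G (x - r t))) = w t := fun t ht => by
    rw [hwork t ht, (hV t ht).2]
  have hchar : ∀ ξ, ∀ t ∈ Icc 0 h, charCurve lam (fun t x => G (x - r t)) ξ t = ξ + r t := by
    intro ξ t ht
    have h1 : ∫ s in (0 : ℝ)..t, lam (work (fun x => G (x - r s))) = ∫ s in (0 : ℝ)..t, w s := by
      refine intervalIntegral.integral_congr fun s hs => hlamw s ?_
      rw [uIcc_of_le ht.1] at hs
      exact ⟨hs.1, hs.2.trans ht.2⟩
    rw [charCurve, h1, intervalIntegral.integral_eq_sub_of_hasDerivAt (fun s _ => hrd s)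
      (hw.intervalIntegrable _ _), hr0, sub_zero]
  have hreg : ∀ t x : ℝ,
      (t, x) ∈ (Icc 0 h ×ˢ Icc 0 1) \ singularSet lam f (fun t x => G (x - r t)) h →
      ContDiffWithinAt ℝ 1 G (Icc (-b) 1) (x - r t) := by
    rintro t x ⟨⟨ht, hx⟩, hns⟩
    simp only at ht hx
    refine hGreg _ (hmap t ht x hx) (fun hbr => hns (Or.inl ⟨ht, x - r t, hbr, ?_, ?_⟩))
      (fun _ hbr => hns (Or.inr ⟨ht, x - r t + 1, hbr, ?_, ?_, ?_⟩))
    all_goals simp only [hchar _ t ht]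
    · linarith [hx.2]
    · ring
    · linarith [hx.1]
    · linarith [hx.2]
    · ring
  have hrC1 : ContDiff ℝ 1 r := by
    rw [contDiff_one_iff_deriv]
    refine ⟨fun t => (hrd t).differentiableAt, ?_⟩
    have : deriv r = w := funext fun t => (hrd t).deriv
    rwa [this]
  refine ⟨fun t x => G (x - r t), hpc1, ?_, ?_, ?_, ?_, ?_, ?_, ?_⟩
  · intro t ht x hx
    exact hlow0.trans_le (hlow _ (hmap t ht x hx))
  · intro t ht
    refine hlow0.trans_le (le_csInf ⟨_, 0, by simp, rfl⟩ ?_)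
    rintro _ ⟨x, hx, rfl⟩
    exact hlow _ (hmap t ht x hx)
  · refine ContinuousOn.congr (f := fun t => work f + u * t - outflow f (r t)) ?_ hwork
    have := hf.continuous_outflow
    exact Continuous.continuousOn (by fun_prop)
  · rintro ⟨t, x⟩ hp
    have h1 : ContDiffWithinAt ℝ 1 (fun p : ℝ × ℝ => p.2 - r p.1)
        ((Icc 0 h ×ˢ Icc 0 1) \ singularSet lam f (fun t x => G (x - r t)) h) (t, x) :=
      (contDiff_snd.sub (hrC1.comp contDiff_fst)).contDiffWithinAt
    exact (hreg t x hp).comp (t, x) h1 fun p hp => hmap p.1 hp.1.1 p.2 hp.1.2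
  · rintro t x hp
    obtain ⟨ht, hx⟩ : t ∈ Icc 0 h ∧ x ∈ Icc (0 : ℝ) 1 := hp.1
    have h1 := ((hreg t x hp).differentiableWithinAt (by simp)).hasDerivWithinAt
    have h2 := HasDerivWithinAt.comp (h₂ := G) (h := fun s => x - r s) t h1
      ((hrd t).const_sub x).hasDerivWithinAt fun s hs => hmap s hs x hx
    have h3 := HasDerivWithinAt.comp (h₂ := G) (h := fun z => z - r t) x h1
      ((hasDerivAt_id x).sub_const (r t)).hasDerivWithinAt fun z hz => hmap t ht z hz
    change HasDerivWithinAt (fun s => G (x - r s)) _ (Icc 0 h) t at h2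
    change HasDerivWithinAt (fun z => G (z - r t)) _ (Icc 0 1) x at h3
    rw [h2.derivWithin (uniqueDiffOn_Icc hh t ht), h3.derivWithin (uniqueDiffOn_Icc one_pos x hx),
      hlamw t ht]
    ring
  · intro t ht
    have h1 := hlamw t ht
    have h2 := hr1 t ht
    change G (0 - r t) * lam (work fun x => G (x - r t)) = u
    rw [h1, hGw _ (by linarith [h2.1]), zero_sub, neg_neg, hqr, div_mul_cancel₀ _ (hwpos t).ne']
  · intro x hx
    simp only [hr0, sub_zero]
    exact hGf x hx.1

end Existence

/-! ### Decay over one sampling interval -/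

theorem abs_sub_le_of_abs_log_le {p ρs a B : ℝ} (hp : 0 < p) (hρ : 0 < ρs)
    (h : |Real.log (p / ρs)| ≤ a) (haB : a ≤ B) : |p - ρs| ≤ ρs * Real.exp B * a := by
  set l := Real.log (p / ρs) with hl
  have hpe : p = ρs * Real.exp l := by
    rw [hl, Real.exp_log (div_pos hp hρ)]; field_simp
  have h1 : |Real.exp l - 1| ≤ Real.exp B * a := by
    have hB0 : 0 ≤ B := (abs_nonneg l).trans (h.trans haB)
    have ha0 : 0 ≤ a := (abs_nonneg l).trans h
    rw [abs_le]
    constructor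
    · have h2 := Real.add_one_le_exp l
      have h3 : 1 ≤ Real.exp B := Real.one_le_exp hB0
      have h4 := mul_le_mul_of_nonneg_right h3 ha0
      linarith [(abs_le.1 h).1]
    · have h2 := Real.add_one_le_exp (-l)
      have h3 : Real.exp l * Real.exp (-l) = 1 := by rw [← Real.exp_add]; simp
      have h4 := mul_le_mul_of_nonneg_left h2 (Real.exp_pos l).le
      have h5 : Real.exp l * l ≤ Real.exp l * a :=
        mul_le_mul_of_nonneg_left (abs_le.1 h).2 (Real.exp_pos l).le
      have h6 : Real.exp l * a ≤ Real.exp B * a :=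
        mul_le_mul_of_nonneg_right (Real.exp_le_exp.2 ((abs_le.1 h).2.trans haB)) ha0
      linarith
  have h2 : p - ρs = ρs * (Real.exp l - 1) := by rw [hpe]; ring
  rw [h2, abs_mul, abs_of_pos hρ, mul_assoc]
  exact mul_le_mul_of_nonneg_left h1 hρ.le

theorem le_mul_exp_of_abs_log_le {p ρs a : ℝ} (hp : 0 < p) (hρ : 0 < ρs)
    (h : |Real.log (p / ρs)| ≤ a) : p ≤ ρs * Real.exp a := by
  have h1 := (Real.log_le_iff_le_exp (div_pos hp hρ)).1 ((le_abs_self _).trans h)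
  rwa [div_le_iff₀' hρ] at h1

theorem abs_log_div_le {a b κ : ℝ} (hκ : 0 < κ) (ha : κ ≤ a) (hb : κ ≤ b) :
    |Real.log (a / b)| ≤ |a - b| / κ := by
  have key : ∀ a b : ℝ, κ ≤ a → κ ≤ b → Real.log (a / b) ≤ |a - b| / κ := by
    intro a b ha hb
    have hb0 := hκ.trans_le hb
    have ha0 := hκ.trans_le ha
    calc Real.log (a / b) ≤ a / b - 1 := Real.log_le_sub_one_of_pos (div_pos ha0 hb0)
      _ = (a - b) / b := by field_simp
      _ ≤ |a - b| / b := div_le_div_of_nonneg_right (le_abs_self _) hb0.le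
      _ ≤ |a - b| / κ := div_le_div_of_nonneg_left (abs_nonneg _) hκ hb
  rw [abs_le]
  constructor
  · have h1 := key b a hb ha
    rw [← inv_div, Real.log_inv, abs_sub_comm] at h1
    linarith
  · exact key a b ha hb

theorem IsPC1.work_le {g : ℝ → ℝ} {C : ℝ} (hg : IsPC1 g) (h : ∀ x ∈ Ioc (0 : ℝ) 1, g x ≤ C) :
    work g ≤ C := by
  have h1 := intervalIntegral.integral_mono_on_of_le_Ioo zero_le_one
    (hg.intervalIntegrable le_rfl zero_le_one le_rfl) (intervalIntegrable_const (c := C))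
    fun x hx => h x (Ioo_subset_Ioc_self hx)
  simpa [work] using h1

theorem IsPC1.abs_outflow_sub_mul_le {f : ℝ → ℝ} {ρs C p : ℝ} (hf : IsPC1 f)
    (h : ∀ x ∈ Ioc (0 : ℝ) 1, |f x - ρs| ≤ C) (hp0 : 0 ≤ p) (hp1 : p ≤ 1) :
    |outflow f p - ρs * p| ≤ C * p := by
  have h1 : outflow f p - ρs * p = ∫ x in (1 - p)..1, (profileExt f x - ρs) := by
    rw [intervalIntegral.integral_sub (hf.intervalIntegrable_profileExt _ _)
      intervalIntegrable_const, intervalIntegral.integral_const, outflow, smul_eq_mul]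
    ring
  have h2 := intervalIntegral.norm_integral_le_of_norm_le_const (a := 1 - p) (b := 1)
    (f := fun x => profileExt f x - ρs) (C := C) (fun x hx => by
      rw [uIoc_of_le (by linarith)] at hx
      have hx1 : x ∈ Ioc (0 : ℝ) 1 := ⟨by linarith [hx.1], hx.2⟩
      rw [Real.norm_eq_abs, profileExt_of_mem hx1]
      exact h x hx1)
  rw [h1]
  rwa [sub_sub_cancel, abs_of_nonneg hp0] at h2

section Decay

variable {lam : ℝ → ℝ} {K ρs h : ℝ} {f : ℝ → ℝ} {y : ℝ → ℝ → ℝ}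

/-- Over one sampling interval the content changes by at most a multiple of `h` times the deviation
`C` of the initial profile from the set-point. -/
theorem IsConstInputSolution.abs_work_sub_le
    (hy : IsConstInputSolution lam (ρs * lam (work f)) f h y)
    (hpos : ∀ s, 0 ≤ s → 0 < lam s)
    (hanti : AntitoneOn lam (Ici 0)) (hK : 0 ≤ K)
    (hL : ∀ a b, 0 ≤ a → 0 ≤ b → |lam a - lam b| ≤ K * |a - b|)
    (hf : IsPC1 f) (hρ : 0 < ρs) (hh : 0 ≤ h) (hh2 : ρs * K * h ≤ 1 / 2)
    {r : ℝ → ℝ} (hr0 : r 0 = 0) (hr1 : ∀ t ∈ Icc 0 h, r t ∈ Ico 0 1)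
    (hrd : ∀ t ∈ Icc 0 h, HasDerivAt r (lam (work (y t))) t)
    (hV : ∀ t ∈ Icc 0 h, work (y t) = work f + ρs * lam (work f) * t - outflow f (r t))
    {C : ℝ} (hC : ∀ x ∈ Ioc (0 : ℝ) 1, |f x - ρs| ≤ C) :
    ∀ t ∈ Icc 0 h, |work (y t) - work f| ≤ 2 * C * lam 0 * h := by
  have hC0 : 0 ≤ C := (abs_nonneg _).trans (hC 1 (by simp))
  have hl0 := hpos 0 le_rfl
  have h00 : (0 : ℝ) ∈ Icc 0 h := ⟨le_rfl, hh⟩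
  have hV0 : work (y 0) = work f := by rw [hV 0 h00, hr0, outflow_zero]; ring
  have hVpos : ∀ t ∈ Icc 0 h, 0 < work (y t) := fun t ht => hy.work_pos ht
  have hW0 : 0 < work f := hV0 ▸ hVpos 0 h00
  -- the largest deviation is attained, and it is absorbed because `ρs * K * h ≤ 1 / 2`
  obtain ⟨t₁, ht₁, hmax⟩ := isCompact_Icc.exists_isMaxOn ⟨0, h00⟩
    ((hy.work_cont.sub continuousOn_const).abs : ContinuousOn (fun t => |work (y t) - work f|) _)
  set D := |work (y t₁) - work f| with hD
  have hDle : ∀ t ∈ Icc 0 h, |work (y t) - work f| ≤ D := fun t ht => hmax ht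
  -- compare the amount that entered with the displacement filled at the set-point density
  have hdrift : ∀ t ∈ Icc 0 h, |lam (work f) * t - r t| ≤ K * D * t := by
    intro t ht
    have := (convex_Icc (0 : ℝ) h).norm_image_sub_le_of_norm_hasDerivWithin_le
      (f := fun t => lam (work f) * t - r t) (f' := fun t => lam (work f) * 1 - lam (work (y t)))
      (C := K * D) (x := 0) (y := t)
      (fun s hs => (((hasDerivAt_id s).const_mul _).sub (hrd s hs)).hasDerivWithinAt)
      (fun s hs => by
        rw [mul_one, Real.norm_eq_abs]
        refine (hL _ _ hW0.le (hVpos s hs).le).trans (mul_le_mul_of_nonneg_left ?_ hK)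
        rw [abs_sub_comm]; exact hDle s hs) h00 ht
    simpa [hr0, Real.norm_eq_abs, abs_of_nonneg ht.1] using this
  have hrle : ∀ t ∈ Icc 0 h, r t ≤ lam 0 * t := by
    intro t ht
    have := (convex_Icc (0 : ℝ) h).norm_image_sub_le_of_norm_hasDerivWithin_le
      (f := r) (f' := fun t => lam (work (y t))) (C := lam 0) (x := 0) (y := t)
      (fun s hs => (hrd s hs).hasDerivWithinAt)
      (fun s hs => by
        rw [Real.norm_of_nonneg (hpos _ (hVpos s hs).le).le]
        exact hanti (mem_Ici.2 le_rfl) (hVpos s hs).le (hVpos s hs).le) h00 ht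
    simp only [hr0, sub_zero, Real.norm_eq_abs, abs_of_nonneg ht.1] at this
    exact (le_abs_self _).trans this
  have hDb : D ≤ C * lam 0 * h + ρs * K * h * D := by
    have e : work (y t₁) - work f =
        ρs * (lam (work f) * t₁ - r t₁) - (outflow f (r t₁) - ρs * r t₁) := by
      rw [hV t₁ ht₁]; ring
    have h1 : |ρs * (lam (work f) * t₁ - r t₁)| ≤ ρs * (K * D * t₁) := by
      rw [abs_mul, abs_of_pos hρ]
      exact mul_le_mul_of_nonneg_left (hdrift t₁ ht₁) hρ.le
    have h2 := hf.abs_outflow_sub_mul_le hC (hr1 t₁ ht₁).1 (hr1 t₁ ht₁).2.le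
    have h3 : C * r t₁ ≤ C * (lam 0 * h) := mul_le_mul_of_nonneg_left
      ((hrle t₁ ht₁).trans (mul_le_mul_of_nonneg_left ht₁.2 hl0.le)) hC0
    have h4 : ρs * (K * D * t₁) ≤ ρs * (K * D * h) :=
      mul_le_mul_of_nonneg_left (mul_le_mul_of_nonneg_left ht₁.2
        (mul_nonneg hK (abs_nonneg _))) hρ.le
    calc D ≤ |ρs * (lam (work f) * t₁ - r t₁)| + |outflow f (r t₁) - ρs * r t₁| := by
          rw [hD, e]; exact abs_sub _ _
      _ ≤ ρs * (K * D * h) + C * (lam 0 * h) := add_le_add (h1.trans h4) (h2.trans h3)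
      _ = _ := by ring
  have h5 : ρs * K * h * D ≤ 1 / 2 * D := mul_le_mul_of_nonneg_right hh2 (abs_nonneg _)
  intro t ht
  have := hDle t ht
  linarith

/-- The decay estimate over one sampling interval, in a form that can be iterated: the weight
`exp (σ * x)` decays along the characteristics at the rate `σ * c`, where `c` is a lower bound of the
speed. Here `κ` is a crude a priori lower bound of the speed. -/
theorem IsConstInputSolution.abs_log_le {σ R L₀ A κ : ℝ}
    (hy : IsConstInputSolution lam (ρs * lam (work f)) f h y)
    (hlam : ContinuousOn lam (Ici 0)) (hpos : ∀ s, 0 ≤ s → 0 < lam s)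
    (hanti : AntitoneOn lam (Ici 0)) (hK : 0 ≤ K)
    (hL : ∀ a b, 0 ≤ a → 0 ≤ b → |lam a - lam b| ≤ K * |a - b|)
    (hf : IsPC1 f) (hfp : ∀ x ∈ Ioc (0 : ℝ) 1, 0 < f x) (hρ : 0 < ρs) (hσ : 0 < σ) (hh : 0 ≤ h)
    (hA : 0 ≤ A) (hAL : A ≤ L₀) (hLR : L₀ ≤ R)
    (hfA : ∀ x ∈ Ioc (0 : ℝ) 1, |Real.log (f x / ρs)| ≤ A * Real.exp (σ * x))
    (hκ : κ = lam (ρs * Real.exp (Real.exp σ * R) + ρs))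
    (hh1 : lam 0 * h ≤ 1 / 2) (hh2 : ρs * K * h ≤ 1 / 2)
    (hh3 : 2 * K * lam 0 * ρs * Real.exp (Real.exp σ * R) * Real.exp σ ^ 2 / κ * h ≤ 1) :
    ∀ t ∈ Icc 0 h, ∀ x ∈ Icc (0 : ℝ) 1, |Real.log (y t x / ρs)| ≤
      A * Real.exp (σ * (x - lam (ρs * Real.exp (Real.exp σ * L₀)) * t)) := by
  obtain ⟨r, hr0, hmono, hr1, hrd, hV, hrep⟩ :=
    hy.exists_representation hlam hpos hanti hf hh (by linarith)
  set E := Real.exp σ with hE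
  set c := lam (ρs * Real.exp (E * L₀)) with hc
  have hE0 : 0 < E := Real.exp_pos σ
  have hl0 := hpos 0 le_rfl
  have hVpos : ∀ t ∈ Icc 0 h, 0 < work (y t) := fun t ht => hy.work_pos ht
  have h00 : (0 : ℝ) ∈ Icc 0 h := ⟨le_rfl, hh⟩
  have hV0 : work (y 0) = work f := by rw [hV 0 h00, hr0, outflow_zero]; ring
  have hW0 : 0 < work f := hV0 ▸ hVpos 0 h00
  have hc0 : 0 < c := hpos _ (by positivity)
  have hcl : c ≤ lam 0 := hanti (mem_Ici.2 le_rfl) (mem_Ici.2 (by positivity)) (by positivity)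
  have hfE : ∀ x ∈ Ioc (0 : ℝ) 1, |Real.log (f x / ρs)| ≤ E * A := by
    intro x hx
    refine (hfA x hx).trans ?_
    rw [mul_comm]
    refine mul_le_mul_of_nonneg_right (Real.exp_le_exp.2 ?_) hA
    nlinarith [hx.2]
  have hEAR : E * A ≤ E * R := mul_le_mul_of_nonneg_left (hAL.trans hLR) hE0.le
  have hWle : work f ≤ ρs * Real.exp (E * R) := hf.work_le fun x hx =>
    (le_mul_exp_of_abs_log_le (hfp x hx) hρ ((hfE x hx).trans hEAR))
  have hdev : ∀ x ∈ Ioc (0 : ℝ) 1, |f x - ρs| ≤ ρs * Real.exp (E * R) * (E * A) := fun x hx =>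
    abs_sub_le_of_abs_log_le (hfp x hx) hρ (hfE x hx) hEAR
  have hvar := hy.abs_work_sub_le hpos hanti hK hL hf hρ hh hh2 hr0 hr1 hrd hV hdev
  have hVle : ∀ t ∈ Icc 0 h, work (y t) ≤ ρs * Real.exp (E * R) + ρs := by
    intro t ht
    have h1 : 0 ≤ outflow f (r t) := by
      refine intervalIntegral.integral_nonneg (by linarith [(hr1 t ht).1]) fun x hx => ?_
      unfold profileExt
      split_ifs with hx'
      · exact (hfp x hx').le
      · exact (hfp 1 (by simp)).le
    have h2 : lam (work f) ≤ lam 0 := hanti (mem_Ici.2 le_rfl) hW0.le hW0.le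
    have h3 : lam (work f) * t ≤ 1 := by
      have := mul_le_mul h2 ht.2 ht.1 hl0.le
      linarith
    have h4 : ρs * lam (work f) * t ≤ ρs := by
      rw [mul_assoc]; exact mul_le_of_le_one_right hρ.le h3
    rw [hV t ht]
    linarith
  have hκ0 : 0 < κ := by rw [hκ]; exact hpos _ (by positivity)
  have hκle : ∀ t ∈ Icc 0 h, κ ≤ lam (work (y t)) := fun t ht => by
    rw [hκ]; exact hanti (hVpos t ht).le (mem_Ici.2 (by positivity)) (hVle t ht)
  -- the density at the inlet; by the smallness of `h` the factor `exp (-σ)` is gained, which pays for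
  -- the decay of the bound during the interval
  have hin : ∀ s ∈ Icc 0 h, |Real.log (ρs * lam (work f) / lam (work (y s)) / ρs)| ≤
      A * Real.exp (-σ) := by
    intro s hs
    have e : ρs * lam (work f) / lam (work (y s)) / ρs = lam (work f) / lam (work (y s)) := by
      field_simp
    rw [e]
    refine (abs_log_div_le hκ0 (hV0 ▸ hκle 0 h00) (hκle s hs)).trans ?_
    have h1 : |lam (work f) - lam (work (y s))| ≤
        K * (2 * (ρs * Real.exp (E * R) * (E * A)) * lam 0 * h) := by
      refine (hL _ _ hW0.le (hVpos s hs).le).trans (mul_le_mul_of_nonneg_left ?_ hK)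
      rw [abs_sub_comm]; exact hvar s hs
    have h2 : Real.exp (-σ) = E⁻¹ := Real.exp_neg σ
    calc |lam (work f) - lam (work (y s))| / κ
        ≤ K * (2 * (ρs * Real.exp (E * R) * (E * A)) * lam 0 * h) / κ :=
          div_le_div_of_nonneg_right h1 hκ0.le
      _ = (2 * K * lam 0 * ρs * Real.exp (E * R) * E ^ 2 / κ * h) * (A * E⁻¹) := by
          field_simp
      _ ≤ 1 * (A * E⁻¹) := mul_le_mul_of_nonneg_right hh3 (by positivity)
      _ = A * Real.exp (-σ) := by rw [one_mul, h2]
  -- the deviation stays below `exp σ * A`, hence the content below the value that defines `c`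
  have hcrude : ∀ t ∈ Icc 0 h, ∀ x ∈ Icc (0 : ℝ) 1, |Real.log (y t x / ρs)| ≤ E * A := by
    intro t ht x hx
    rcases lt_or_ge (r t) x with hlt | hle
    · rw [(hrep t ht x hx).1 hlt]
      exact hfE _ ⟨by linarith, by linarith [(hr1 t ht).1, hx.2]⟩
    · obtain ⟨s, hs, -, hs2⟩ := (hrep t ht x hx).2 hle
      rw [hs2, mul_comm E A]
      refine (hin s ⟨hs.1, hs.2.trans ht.2⟩).trans (mul_le_mul_of_nonneg_left ?_ hA)
      exact Real.exp_le_exp.2 (by linarith)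
  have hspeed : ∀ t ∈ Icc 0 h, c ≤ lam (work (y t)) := by
    intro t ht
    refine hanti (hVpos t ht).le (mem_Ici.2 (by positivity)) ?_
    refine (hy.pc1 t ht).work_le fun x hx => ?_
    have hx' := Ioc_subset_Icc_self hx
    exact le_mul_exp_of_abs_log_le (hy.pos t ht x hx') hρ
      ((hcrude t ht x hx').trans (mul_le_mul_of_nonneg_left hAL hE0.le))
  have hprog : ∀ s ∈ Icc 0 h, ∀ t ∈ Icc 0 h, s ≤ t → c * (t - s) ≤ r t - r s := by
    intro s hs t ht hst
    refine (convex_Icc (0 : ℝ) h).mul_sub_le_image_sub_of_le_deriv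
      (fun t ht => (hrd t ht).continuousAt.continuousWithinAt)
      (fun t ht => ?_) (fun t ht => ?_) s hs t ht hst
    · exact (hrd t (interior_subset ht)).differentiableAt.differentiableWithinAt
    · rw [(hrd t (interior_subset ht)).deriv]
      exact hspeed t (interior_subset ht)
  intro t ht x hx
  rcases lt_or_ge (r t) x with hlt | hle
  · rw [(hrep t ht x hx).1 hlt]
    refine (hfA _ ⟨by linarith, by linarith [(hr1 t ht).1, hx.2]⟩).trans
      (mul_le_mul_of_nonneg_left (Real.exp_le_exp.2 (mul_le_mul_of_nonneg_left ?_ hσ.le)) hA)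
    have := hprog 0 h00 t ht ht.1
    rw [hr0] at this
    linarith
  · obtain ⟨s, hs, hs1, hs2⟩ := (hrep t ht x hx).2 hle
    have hsh : s ∈ Icc 0 h := ⟨hs.1, hs.2.trans ht.2⟩
    rw [hs2]
    refine (hin s hsh).trans (mul_le_mul_of_nonneg_left (Real.exp_le_exp.2 ?_) hA)
    have h1 := hprog s hsh t ht hs.2
    have h2 : c * s ≤ lam 0 * h := mul_le_mul hcl hsh.2 hs.1 hl0.le
    have h3 : -1 ≤ x - c * t := by linarith
    calc -σ = σ * (-1) := by ring
      _ ≤ _ := mul_le_mul_of_nonneg_left h3 hσ.le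

end Decay

/-! ### The closed loop -/

section ClosedLoop

variable {lam : ℝ → ℝ} {K ρs : ℝ} {ρ₀ : ℝ → ℝ} {t : ℕ → ℝ}

theorem breakPoints_congr {f f' : ℝ → ℝ} (h : EqOn f f' (Ioc 0 1)) :
    breakPoints f = breakPoints f' := by
  ext x
  by_cases hx0 : x = 0
  · simp [breakPoints, hx0]
  simp only [breakPoints, mem_union, mem_singleton_iff, hx0, false_or, mem_ofPred_eq]
  refine and_congr_right fun hx => not_congr ?_
  have hxp : 0 < x := lt_of_le_of_ne hx.1 (Ne.symm hx0)
  have e : f =ᶠ[𝓝[Icc 0 1] x] f' := by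
    filter_upwards [self_mem_nhdsWithin, mem_nhdsWithin_of_mem_nhds (Ioi_mem_nhds hxp)]
      with z hz hz'
    exact h ⟨hz', hz.2⟩
  have ex : f x = f' x := h ⟨hxp, hx.2⟩
  exact ⟨fun hc => hc.congr_of_eventuallyEq e.symm ex.symm, fun hc => hc.congr_of_eventuallyEq e ex⟩

/-- The value of the initial profile at `0` plays no role. -/
theorem IsConstInputSolution.congr {u h : ℝ} {f f' : ℝ → ℝ} {y : ℝ → ℝ → ℝ}
    (hy : IsConstInputSolution lam u f h y) (hff' : EqOn f f' (Ioc 0 1)) :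
    IsConstInputSolution lam u f' h y := by
  have hs : singularSet lam f y h = singularSet lam f' y h := by
    simp only [singularSet, breakPoints_congr hff']
  refine ⟨hy.pc1, hy.pos, hy.inf_pos, hy.work_cont, ?_, ?_, hy.boundary, fun x hx => ?_⟩
  · rw [← hs]; exact hy.regular
  · rw [← hs]; exact hy.pde
  · rw [← hff' hx]; exact hy.initial x hx

theorem exists_mem_Ico_of_tendsto_atTop (ht0 : t 0 = 0) (htop : Tendsto t atTop atTop) {s : ℝ}
    (hs : 0 ≤ s) : ∃ i, s ∈ Ico (t i) (t (i + 1)) := by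
  classical
  have hex : ∃ n, s < t n := (htop.eventually_gt_atTop s).exists
  have hn := Nat.find_spec hex
  have hn0 : Nat.find hex ≠ 0 := by
    intro h
    rw [h, ht0] at hn
    linarith
  obtain ⟨i, hi⟩ := Nat.exists_eq_succ_of_ne_zero hn0
  refine ⟨i, not_lt.1 (Nat.find_min hex (by omega)), ?_⟩
  rwa [hi] at hn

theorem eq_of_mem_Ico_of_strictMono (hmono : StrictMono t) {s : ℝ} {i j : ℕ}
    (hi : s ∈ Ico (t i) (t (i + 1))) (hj : s ∈ Ico (t j) (t (j + 1))) : i = j := by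
  have h1 := hmono.lt_iff_lt.1 (hi.1.trans_lt hj.2)
  have h2 := hmono.lt_iff_lt.1 (hj.1.trans_lt hi.2)
  omega

/-- A set with positive infimum is bounded below, as `sInf` is `0` otherwise. -/
theorem le_of_sInf_pos {f : ℝ → ℝ} {S : Set ℝ} (h : 0 < sInf (f '' S)) :
    ∀ x ∈ S, sInf (f '' S) ≤ f x := by
  intro x hx
  refine csInf_le ?_ ⟨x, hx, rfl⟩
  by_contra hb
  rw [Real.sInf_of_not_bddBelow hb] at h
  exact lt_irrefl _ h

/-- Existence for the closed loop: the solutions `Y i` of the constant-input problems are chained, the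
terminal profile of each being the initial profile `F (i + 1)` of the next. -/
theorem exists_isSampledSolution (hlam : ContDiffOn ℝ 1 lam (Ici 0))
    (hpos : ∀ s, 0 ≤ s → 0 < lam s)
    (hanti : AntitoneOn lam (Ici 0)) (hK : 0 ≤ K)
    (hL : ∀ a b, 0 ≤ a → 0 ≤ b → |lam a - lam b| ≤ K * |a - b|) (hρ : 0 < ρs)
    (hf : IsPC1 ρ₀) (hinf : 0 < sInf (ρ₀ '' Ioc 0 1)) (ht0 : t 0 = 0) (hmono : StrictMono t)
    (htop : Tendsto t atTop atTop) (hstep : ∀ i, lam 0 * (t (i + 1) - t i) < 1) :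
    ∃ ρ, IsSampledSolution lam ρs t ρ₀ ρ := by
  have hdt : ∀ i, 0 < t (i + 1) - t i := fun i => sub_pos.2 (hmono (Nat.lt_succ_self i))
  have hone : ∀ (i : ℕ) (f : {f : ℝ → ℝ // IsPC1 f ∧ 0 < sInf (f '' Ioc 0 1)}),
      ∃ y, IsConstInputSolution lam (ρs * lam (work f.1)) f.1 (t (i + 1) - t i) y := by
    rintro i ⟨f, hf, hfi⟩
    have hm := le_of_sInf_pos hfi
    exact exists_isConstInputSolution hlam hpos hanti hK hL hf hfi hm
      (mul_pos hρ (hpos _ (hf.work_pos fun x hx => hfi.trans_le (hm x hx)).le)) (hdt i) (hstep i)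
  choose Y hY using hone
  have hinfmono : ∀ f : ℝ → ℝ, 0 < sInf (f '' Icc 0 1) → 0 < sInf (f '' Ioc 0 1) := by
    intro f h
    refine h.trans_le (le_csInf ⟨_, 1, by simp, rfl⟩ ?_)
    rintro _ ⟨x, hx, rfl⟩
    exact le_of_sInf_pos h x (Ioc_subset_Icc_self hx)
  have hend : ∀ i, t (i + 1) - t i ∈ Icc 0 (t (i + 1) - t i) := fun i => ⟨(hdt i).le, le_rfl⟩
  let F : ℕ → {f : ℝ → ℝ // IsPC1 f ∧ 0 < sInf (f '' Ioc 0 1)} := fun n =>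
    Nat.rec ⟨ρ₀, hf, hinf⟩ (fun i f => ⟨Y i f (t (i + 1) - t i), (hY i f).pc1 _ (hend i),
      hinfmono _ ((hY i f).inf_pos _ (hend i))⟩) n
  have hF0 : (F 0).1 = ρ₀ := rfl
  have hFs : ∀ i, (F (i + 1)).1 = Y i (F i) (t (i + 1) - t i) := fun i => rfl
  have hidx : ∀ s, ∃ i, 0 ≤ s → s ∈ Ico (t i) (t (i + 1)) := fun s => by
    by_cases hs : 0 ≤ s
    · obtain ⟨i, hi⟩ := exists_mem_Ico_of_tendsto_atTop ht0 htop hs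
      exact ⟨i, fun _ => hi⟩
    · exact ⟨0, fun h => absurd h hs⟩
  choose N hN using hidx
  have htnn : ∀ i, 0 ≤ t i := fun i => ht0 ▸ hmono.monotone (Nat.zero_le i)
  have hNe : ∀ i s, s ∈ Ico (t i) (t (i + 1)) → N s = i := fun i s hs =>
    eq_of_mem_Ico_of_strictMono hmono (hN s ((htnn i).trans hs.1)) hs
  have hNt : ∀ i, N (t i) = i := fun i => hNe i _ ⟨le_rfl, hmono (Nat.lt_succ_self i)⟩
  set ρ : ℝ → ℝ → ℝ := fun s => Y (N s) (F (N s)) (s - t (N s)) with hρdef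
  have hloc : ∀ s, 0 ≤ s → s - t (N s) ∈ Icc 0 (t (N s + 1) - t (N s)) := fun s hs =>
    ⟨by linarith [(hN s hs).1], by linarith [(hN s hs).2]⟩
  have hρt : ∀ i, ρ (t i) = Y i (F i) 0 := fun i => by simp only [hρdef, hNt, sub_self]
  have hρF : ∀ i, EqOn (F i).1 (ρ (t i)) (Ioc 0 1) := fun i x hx => by
    rw [hρt]; exact ((hY i (F i)).initial x hx).symm
  refine ⟨ρ, fun s hs => (hY _ _).pc1 _ (hloc s hs), fun s hs => (hY _ _).pos _ (hloc s hs),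
    fun s hs => (hY _ _).inf_pos _ (hloc s hs), fun x hx => ?_, fun i => ?_⟩
  · have := hρF 0 hx
    rw [ht0] at this
    rw [← this, hF0]
  · refine ⟨Y i (F i), ?_, ?_, ?_⟩
    · have := (hY i (F i)).congr (hρF i)
      rwa [work_congr (hρF i)] at this
    · intro s hs x _
      have : N (t i + s) = i := hNe i _ ⟨by linarith [hs.1], by linarith [hs.2]⟩
      simp only [hρdef, this, add_sub_cancel_left]
    · intro x hx
      rw [← hρF (i + 1) hx, hFs]

/-- Uniqueness for the closed loop, by induction over the sampling times: the profile on `(0,1]`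
determines both the next input and the next solution. -/
theorem IsSampledSolution.unique {ρ ρ' : ℝ → ℝ → ℝ} (h : IsSampledSolution lam ρs t ρ₀ ρ)
    (h' : IsSampledSolution lam ρs t ρ₀ ρ') (hlam : ContinuousOn lam (Ici 0))
    (hpos : ∀ s, 0 ≤ s → 0 < lam s) (hanti : AntitoneOn lam (Ici 0)) (hK : 0 ≤ K)
    (hL : ∀ a b, 0 ≤ a → 0 ≤ b → |lam a - lam b| ≤ K * |a - b|)
    (ht0 : t 0 = 0) (hmono : StrictMono t)
    (htop : Tendsto t atTop atTop) (hstep : ∀ i, lam 0 * (t (i + 1) - t i) < 1) :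
    ∀ s, 0 ≤ s → ∀ x ∈ Icc (0 : ℝ) 1, ρ' s x = ρ s x := by
  have hdt : ∀ i, 0 < t (i + 1) - t i := fun i => sub_pos.2 (hmono (Nat.lt_succ_self i))
  have htnn : ∀ i, 0 ≤ t i := fun i => ht0 ▸ hmono.monotone (Nat.zero_le i)
  have hone : ∀ i, EqOn (ρ (t i)) (ρ' (t i)) (Ioc 0 1) →
      (∀ s ∈ Ico 0 (t (i + 1) - t i), ∀ x ∈ Icc (0 : ℝ) 1, ρ' (t i + s) x = ρ (t i + s) x) ∧
      EqOn (ρ (t (i + 1))) (ρ' (t (i + 1))) (Ioc 0 1) := by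
    intro i hi
    obtain ⟨y, hy, hy1, hy2⟩ := h.step i
    obtain ⟨y', hy', hy1', hy2'⟩ := h'.step i
    rw [← work_congr hi] at hy'
    have hu := hy.unique hy' hlam hpos hanti hK hL (h.pc1 _ (htnn i)) hi (hdt i).le (hstep i)
    refine ⟨fun s hs x hx => ?_, fun x hx => ?_⟩
    · rw [hy1 s hs x hx, hy1' s hs x hx, hu s (Ico_subset_Icc_self hs) x hx]
    · rw [hy2 x hx, hy2' x hx, hu _ ⟨(hdt i).le, le_rfl⟩ x (Ioc_subset_Icc_self hx)]
  have hall : ∀ i, EqOn (ρ (t i)) (ρ' (t i)) (Ioc 0 1) := by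
    intro i
    induction i with
    | zero =>
      intro x hx
      rw [ht0, h.initial x hx, h'.initial x hx]
    | succ i ih => exact (hone i ih).2
  intro s hs x hx
  obtain ⟨i, hi⟩ := exists_mem_Ico_of_tendsto_atTop ht0 htop hs
  have := (hone i (hall i)).1 (s - t i) ⟨by linarith [hi.1], by linarith [hi.2]⟩ x hx
  rwa [add_sub_cancel] at this

/-- Exponential decay in the closed loop. The bound at the time `t i` is the hypothesis of
`IsConstInputSolution.abs_log_le` with `A = L₀ * exp (-σ * c * t i)`. -/
theorem IsSampledSolution.abs_log_le {ρ : ℝ → ℝ → ℝ} {σ R L₀ κ : ℝ}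
    (h : IsSampledSolution lam ρs t ρ₀ ρ) (hlam : ContinuousOn lam (Ici 0))
    (hpos : ∀ s, 0 ≤ s → 0 < lam s) (hanti : AntitoneOn lam (Ici 0)) (hK : 0 ≤ K)
    (hL : ∀ a b, 0 ≤ a → 0 ≤ b → |lam a - lam b| ≤ K * |a - b|)
    (hρ : 0 < ρs) (hσ : 0 < σ) (hL0 : 0 ≤ L₀) (hLR : L₀ ≤ R)
    (hρ₀ : ∀ x ∈ Ioc (0 : ℝ) 1, |Real.log (ρ₀ x / ρs)| ≤ L₀)
    (ht0 : t 0 = 0) (hmono : StrictMono t) (htop : Tendsto t atTop atTop)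
    (hκ : κ = lam (ρs * Real.exp (Real.exp σ * R) + ρs))
    (hh1 : ∀ i, lam 0 * (t (i + 1) - t i) ≤ 1 / 2)
    (hh2 : ∀ i, ρs * K * (t (i + 1) - t i) ≤ 1 / 2)
    (hh3 : ∀ i, 2 * K * lam 0 * ρs * Real.exp (Real.exp σ * R) * Real.exp σ ^ 2 / κ *
      (t (i + 1) - t i) ≤ 1) :
    ∀ s, 0 ≤ s → ∀ x ∈ Icc (0 : ℝ) 1, |Real.log (ρ s x / ρs)| ≤
      L₀ * Real.exp (σ * (x - lam (ρs * Real.exp (Real.exp σ * L₀)) * s)) := by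
  set c := lam (ρs * Real.exp (Real.exp σ * L₀)) with hc
  have hc0 : 0 < c := hpos _ (by positivity)
  have hdt : ∀ i, 0 < t (i + 1) - t i := fun i => sub_pos.2 (hmono (Nat.lt_succ_self i))
  have htnn : ∀ i, 0 ≤ t i := fun i => ht0 ▸ hmono.monotone (Nat.zero_le i)
  have hone : ∀ i, (∀ x ∈ Ioc (0 : ℝ) 1, |Real.log (ρ (t i) x / ρs)| ≤
        L₀ * Real.exp (σ * (x - c * t i))) →
      (∀ s ∈ Ico 0 (t (i + 1) - t i), ∀ x ∈ Icc (0 : ℝ) 1, |Real.log (ρ (t i + s) x / ρs)| ≤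
        L₀ * Real.exp (σ * (x - c * (t i + s)))) ∧
      (∀ x ∈ Ioc (0 : ℝ) 1, |Real.log (ρ (t (i + 1)) x / ρs)| ≤
        L₀ * Real.exp (σ * (x - c * t (i + 1)))) := by
    intro i hi
    obtain ⟨y, hy, hy1, hy2⟩ := h.step i
    have hA : L₀ * Real.exp (-(σ * c * t i)) ≤ L₀ := by
      refine mul_le_of_le_one_right hL0 (Real.exp_le_one_iff.2 ?_)
      have := mul_nonneg (mul_nonneg hσ.le hc0.le) (htnn i)
      linarith
    have key := hy.abs_log_le (A := L₀ * Real.exp (-(σ * c * t i))) hlam hpos hanti hK hL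
      (h.pc1 _ (htnn i)) (fun x hx => h.pos _ (htnn i) x (Ioc_subset_Icc_self hx)) hρ hσ (hdt i).le
      (by positivity) hA hLR (fun x hx => (hi x hx).trans (le_of_eq (by
        rw [mul_assoc, ← Real.exp_add]; congr 2; ring))) hκ (hh1 i) (hh2 i) (hh3 i)
    refine ⟨fun s hs x hx => ?_, fun x hx => ?_⟩
    · rw [hy1 s hs x hx]
      refine (key s (Ico_subset_Icc_self hs) x hx).trans (le_of_eq ?_)
      rw [mul_assoc, ← Real.exp_add]; congr 2; ring
    · rw [hy2 x hx]
      refine (key _ ⟨(hdt i).le, le_rfl⟩ x (Ioc_subset_Icc_self hx)).trans (le_of_eq ?_)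
      rw [mul_assoc, ← Real.exp_add]; congr 2; ring
  have hall : ∀ i, ∀ x ∈ Ioc (0 : ℝ) 1, |Real.log (ρ (t i) x / ρs)| ≤
        L₀ * Real.exp (σ * (x - c * t i)) := by
    intro i
    induction i with
    | zero =>
      intro x hx
      rw [ht0, h.initial x hx]
      refine (hρ₀ x hx).trans (le_mul_of_one_le_right hL0 (Real.one_le_exp ?_))
      rw [mul_zero, sub_zero]
      exact mul_nonneg hσ.le hx.1.le
    | succ i ih => exact (hone i ih).2
  intro s hs x hx
  obtain ⟨i, hi⟩ := exists_mem_Ico_of_tendsto_atTop ht0 htop hs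
  have := (hone i (hall i)).1 (s - t i) ⟨by linarith [hi.1], by linarith [hi.2]⟩ x hx
  rwa [add_sub_cancel] at this

theorem IsPC1.bddAbove_abs_log {f : ℝ → ℝ} (hf : IsPC1 f) (hinf : 0 < sInf (f '' Ioc 0 1))
    (hρ : 0 < ρs) : BddAbove ((fun x => |Real.log (f x / ρs)|) '' Ioc 0 1) := by
  obtain ⟨M, hM, hfM⟩ := hf.exists_bound
  set m := sInf (f '' Ioc 0 1)
  refine ⟨max (Real.log (M / ρs)) (-Real.log (m / ρs)), ?_⟩
  rintro _ ⟨x, hx, rfl⟩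
  have h1 := le_of_sInf_pos hinf x hx
  have hfx := hinf.trans_le h1
  refine abs_le'.2 ⟨le_max_of_le_left ?_, le_max_of_le_right (neg_le_neg ?_)⟩
  · exact Real.log_le_log (div_pos hfx hρ)
      (div_le_div_of_nonneg_right ((le_abs_self _).trans (hfM x hx)) hρ.le)
  · exact Real.log_le_log (div_pos hinf hρ) (div_le_div_of_nonneg_right h1 hρ.le)

end ClosedLoop

end Reentrant

theorem theorem4 (lam : ℝ → ℝ) (ρs σ K : ℝ)
    (hlam : ContDiffOn ℝ 1 lam (Set.Ici 0))
    (hlam_pos : ∀ s, 0 ≤ s → 0 < lam s)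
    (hlam_anti : AntitoneOn lam (Set.Ici 0))
    (hK : 0 < K)
    (hlam_deriv : ∀ s, 0 ≤ s → |derivWithin lam (Set.Ici 0) s| ≤ K)
    (hρs : 0 < ρs) (hσ : 0 < σ) :
    ∀ R : ℝ, 0 < R → ∃ τ : ℝ, 0 < τ ∧
      ∀ ρ₀ : ℝ → ℝ, Reentrant.IsPC1 ρ₀ → 0 < sInf (ρ₀ '' Set.Ioc 0 1) →
        Reentrant.logSup ρs ρ₀ (Set.Ioc 0 1) ≤ R →
      ∀ t : ℕ → ℝ, t 0 = 0 → StrictMono t → Filter.Tendsto t Filter.atTop Filter.atTop →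
        (∀ i, t (i + 1) - t i ≤ τ) →
      ∃ ρ : ℝ → ℝ → ℝ, Reentrant.IsSampledSolution lam ρs t ρ₀ ρ ∧
        (∀ ρ' : ℝ → ℝ → ℝ, Reentrant.IsSampledSolution lam ρs t ρ₀ ρ' →
          ∀ s, 0 ≤ s → ∀ x ∈ Set.Icc (0 : ℝ) 1, ρ' s x = ρ s x) ∧
        ∀ s, 0 ≤ s →
          BddAbove ((fun x => |Real.log (ρ s x / ρs)|) '' Set.Icc 0 1) ∧
          Reentrant.logSup ρs (ρ s) (Set.Icc 0 1) ≤
            Real.exp (-σ * (lam (ρs * Real.exp (Real.exp σ *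
              Reentrant.logSup ρs ρ₀ (Set.Ioc 0 1))) * s - 1)) *
              Reentrant.logSup ρs ρ₀ (Set.Ioc 0 1) := by
  have hL : ∀ a b, 0 ≤ a → 0 ≤ b → |lam a - lam b| ≤ K * |a - b| := by
    intro a b ha hb
    exact Convex.norm_image_sub_le_of_norm_derivWithin_le (hlam.differentiableOn (by simp))
      (fun s hs => hlam_deriv s hs) (convex_Ici 0) hb ha
  intro R _
  have hl0 := hlam_pos 0 le_rfl
  set κ := lam (ρs * Real.exp (Real.exp σ * R) + ρs) with hκ
  have hκ0 : 0 < κ := hlam_pos _ (by positivity)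
  set Q := 2 * K * lam 0 * ρs * Real.exp (Real.exp σ * R) * Real.exp σ ^ 2 / κ with hQ
  have hQ0 : 0 < Q := by positivity
  -- the summands of `T` correspond to the three smallness conditions in
  -- `IsSampledSolution.abs_log_le`
  set T := 2 * lam 0 + 2 * (ρs * K) + Q with hT
  have hT0 : 0 < T := by positivity
  have hprod : ∀ a d : ℝ, a ≤ T → 0 ≤ d → d ≤ 1 / T → a * d ≤ 1 := by
    intro a d ha hd0 hd
    calc a * d ≤ T * (1 / T) := mul_le_mul ha hd hd0 hT0.le
      _ = 1 := by field_simp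
  have hρK : 0 < ρs * K := mul_pos hρs hK
  refine ⟨1 / T, by positivity, fun ρ₀ hρ₀ hinf hR t ht0 hmono htop hτ => ?_⟩
  have hdt : ∀ i, 0 ≤ t (i + 1) - t i := fun i => (sub_pos.2 (hmono (Nat.lt_succ_self i))).le
  have hh1 : ∀ i, lam 0 * (t (i + 1) - t i) ≤ 1 / 2 := fun i => by
    have := hprod (2 * lam 0) _ (by linarith) (hdt i) (hτ i)
    linarith
  have hh2 : ∀ i, ρs * K * (t (i + 1) - t i) ≤ 1 / 2 := fun i => by
    have := hprod (2 * (ρs * K)) _ (by linarith) (hdt i) (hτ i)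
    linarith
  have hh3 : ∀ i, Q * (t (i + 1) - t i) ≤ 1 := fun i =>
    hprod Q _ (by linarith) (hdt i) (hτ i)
  have hstep : ∀ i, lam 0 * (t (i + 1) - t i) < 1 := fun i => by linarith [hh1 i]
  set L₀ := Reentrant.logSup ρs ρ₀ (Set.Ioc 0 1) with hL₀
  have hle : ∀ x ∈ Set.Ioc (0 : ℝ) 1, |Real.log (ρ₀ x / ρs)| ≤ L₀ := fun x hx =>
    le_csSup (hρ₀.bddAbove_abs_log hinf hρs) ⟨x, hx, rfl⟩
  have hL0 : 0 ≤ L₀ := (abs_nonneg _).trans (hle 1 (by simp))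
  obtain ⟨ρ, hρ⟩ := Reentrant.exists_isSampledSolution hlam hlam_pos hlam_anti hK.le hL hρs hρ₀ hinf
    ht0 hmono htop hstep
  refine ⟨ρ, hρ, fun ρ' hρ' => hρ.unique hρ' hlam.continuousOn hlam_pos hlam_anti hK.le hL ht0 hmono
    htop hstep, fun s hs => ?_⟩
  have hb : ∀ x ∈ Set.Icc (0 : ℝ) 1, |Real.log (ρ s x / ρs)| ≤
      Real.exp (-σ * (lam (ρs * Real.exp (Real.exp σ * L₀)) * s - 1)) * L₀ := by
    intro x hx
    refine (hρ.abs_log_le hlam.continuousOn hlam_pos hlam_anti hK.le hL hρs hσ hL0 hR hle ht0 hmono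
      htop hκ hh1 hh2 hh3 s hs x hx).trans ?_
    rw [mul_comm]
    refine mul_le_mul_of_nonneg_right (Real.exp_le_exp.2 ?_) hL0
    have := mul_le_mul_of_nonneg_left hx.2 hσ.le
    linarith
  have hb' : ∀ v ∈ (fun x => |Real.log (ρ s x / ρs)|) '' Set.Icc 0 1,
      v ≤ Real.exp (-σ * (lam (ρs * Real.exp (Real.exp σ * L₀)) * s - 1)) * L₀ := by
    rintro _ ⟨x, hx, rfl⟩
    exact hb x hx
  exact ⟨⟨_, hb'⟩, csSup_le ⟨_, 0, by simp, rfl⟩ hb'⟩
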